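/- **Setting.** Let $\Gamma\rightrightarrows M$ be a Lie groupoid (manifolds are smooth, finite dimensional, without boundary) and let $$1\to M\times S^1\xrightarrow{\;i\;}\tilde\Gamma\xrightarrow{\;\phi\;}\Gamma\to 1$$ be a central $S^1$-extension: $\tilde\Gamma\rightrightarrows M$ is a Lie groupoid, $i$ and $\phi$ are morphisms of Lie groupoids over the identity of $M$, $i$ is an embedding, $\phi$ is a surjective submersion, the image of $i$ is $\phi^{-1}(\text{units})$, and $i(t(\gamma),z)\,\gamma=\gamma\, i(s(\gamma),z)$ for all $\gamma\in\tilde\Gamma$, $z\in S^1$; write $\gamma\cdot z$ for this element. A product $ab$ is defined when $s(a)=t(b)$. Let $\theta\in\Omega^1(\tilde\Gamma)$ be a pseudo-connection, i.e. a connection 1-form of the principal $S^1$-bundle $\phi:\tilde\Gamma\to\Gamma$: $\theta$ is $S^1$-invariant and $\theta\big(\tfrac{d}{d\tau}\gamma\cdot e^{i\tau}\big|_{\tau=0}\big)=1$ for all $\gamma\in\tilde\Gamma$. **Cohomology of 2-groupoids.** For a strict 2-groupoid $\mathbf G:\ \Gamma_2\rightrightarrows\Gamma_1\rightrightarrows\Gamma_0$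 each 2-arrow $\alpha$ goes from a 1-arrow $u(\alpha)$ to a 1-arrow $l(\alpha)$; the vertical composition $\alpha\star\beta$ is defined when $l(\alpha)=u(\beta)$, and $*$ is the horizontal composition. A $q$-simplex of the geometric nerve $N_\bullet\mathbf G$ consists of objects $A_i$ ($0\le i\le q$), 1-arrows $g_{ij}:A_i\to A_j$ ($i<j$) and 2-arrows $\alpha_{ijk}$ from $g_{jk}g_{ij}$ to $g_{ik}$ ($i<j<k$) with $(g_{kl}*\alpha_{ijk})\star\alpha_{ikl}=(\alpha_{jkl}*g_{ij})\star\alpha_{ijl}$ for $i<j<k<l$; the face map $d_r$ omits the $r$-th vertex. $H^\bullet(\mathbf G)$ is the cohomology of the total complex $\bigoplus_{p+q=n}\Omega^p(N_q\mathbf G)$ with differential $d+\partial$, where $d$ is the de Rham differential and $\partial=(-1)^p\sum_{r=0}^{q+1}(-1)^r d_r^*:\Omega^p(N_q\mathbf G)\to\Omega^p(N_{q+1}\mathbf G)$. Consider the 2-groupoids $$\mathbf A:\ \Gamma\rightrightarrows\Gamma\rightrightarrows M,\qquad \mathbf B:\ \tilde\Gamma\times_\Gamma\tilde\Gamma\rightrightarrows\tilde\Gamma\rightrightarrows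 M,\qquad \mathbf C=[S^1\to 1]:\ S^1\rightrightarrows *\rightrightarrows *,\qquad \mathbf D:\ \tilde\Gamma\rightrightarrows\tilde\Gamma\rightrightarrows M .$$ In $\mathbf A$ and $\mathbf D$ all 2-arrows are identities. In $\mathbf B$ the 2-arrow $(\gamma_1,\gamma_2)$ goes from $\gamma_1$ to $\gamma_2$, with $(\gamma_1,\gamma_2)\star(\gamma_2,\gamma_3)=(\gamma_1,\gamma_3)$ and componentwise horizontal composition. In $\mathbf C$ both compositions are the multiplication of $S^1$. The map $\phi$ induces morphisms $\phi:\mathbf D\to\mathbf A$ and $\phi:\mathbf B\to\mathbf A$, and $f:\mathbf B\to\mathbf C$ is the morphism that sends the 2-arrow $(\gamma_1,\gamma_2)$ to the element $\gamma_1\gamma_2^{-1}$ of $S^1$, i.e. to the $z\in S^1$ with $\gamma_1=\gamma_2\cdot z$. Let $dt$ be the angular (Maurer–Cartan) form on $S^1=N_2\mathbf C$ (for $z=e^{i\tau}$ it is $d\tau$); it is a cocycle of total degree $3$ in $\Omega^1(N_2\mathbf C)$. **Theorem.** There is exactly one 3-cocycle $\Omega_\theta$ of the total complex of $\mathbf A$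 with $\phi^*\Omega_\theta=d\theta+\partial\theta$ in the total complex of $\mathbf D$, where $\theta\in\Omega^1(\tilde\Gamma)=\Omega^1(N_1\mathbf D)$. For this cocycle $$\phi^*[\Omega_\theta]=f^*[dt]\quad\text{in } H^3(\mathbf B).$$ -/

import Mathlib

open scoped Manifold ContDiff
open Diffeology

namespace TwoGpd

universe u v w u' v' w'

/-! ### Differential forms on diffeological spaces -/

section Forms

/-- A plot of dimension `n` of the diffeological space `X`: a smooth map `ℝⁿ → X`. -/
abbrev Plot (X : Type u) [DiffeologicalSpace X] (n : ℕ) :=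
  {P : EuclideanSpace ℝ (Fin n) → X // IsPlot P}

/-- Precomposition of a plot with a smooth map of Euclidean spaces. -/
def Plot.reparam {X : Type u} [DiffeologicalSpace X] {m n : ℕ} (P : Plot X n)
    (F : EuclideanSpace ℝ (Fin m) → EuclideanSpace ℝ (Fin n)) (hF : ContDiff ℝ ∞ F) : Plot X m :=
  ⟨P.1 ∘ F, isPlot_reparam P.2 hF⟩

/-- Postcomposition of a plot with a smooth map of diffeological spaces. -/
def Plot.push {X : Type u} {Y : Type v} [DiffeologicalSpace X] [DiffeologicalSpace Y] {n : ℕ}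
    (P : Plot X n) (f : X → Y) (hf : DSmooth f) : Plot Y n :=
  ⟨f ∘ P.1, P.2.dSmooth_comp hf⟩

/-- The differential `p`-forms on `X`, as a submodule. See `Form`. -/
def formSubmodule (X : Type u) [DiffeologicalSpace X] (p : ℕ) :
    Submodule ℝ (∀ n : ℕ, Plot X n → EuclideanSpace ℝ (Fin n) →
      (EuclideanSpace ℝ (Fin n)) [⋀^Fin p]→L[ℝ] ℝ) where
  carrier := {η | (∀ n (P : Plot X n), ContDiff ℝ ∞ (η n P)) ∧
    ∀ m n (P : Plot X n) (F : EuclideanSpace ℝ (Fin m) → EuclideanSpace ℝ (Fin n))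
      (hF : ContDiff ℝ ∞ F) (x : EuclideanSpace ℝ (Fin m)),
      η m (P.reparam F hF) x = (η n P (F x)).compContinuousLinearMap (fderiv ℝ F x)}
  zero_mem' := ⟨fun _ _ => contDiff_const, fun _ _ _ _ _ _ => rfl⟩
  add_mem' := fun {a b} ha hb => ⟨fun n P => (ha.1 n P).add (hb.1 n P), fun m n P F hF x => by
    have h1 := ha.2 m n P F hF x
    have h2 := hb.2 m n P F hF x
    simp only [Pi.add_apply, h1, h2]
    rfl⟩
  smul_mem' := fun c a ha => ⟨fun n P => (ha.1 n P).const_smul c, fun m n P F hF x => by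
    have h1 := ha.2 m n P F hF x
    simp only [Pi.smul_apply, h1]
    rfl⟩

/-- The real vector space `Ω^p(X)` of (smooth, real) differential `p`-forms on `X`. A form assigns
to every smooth map `P : ℝⁿ → X` a smooth `p`-form `P^*α` on `ℝⁿ`, compatibly with smooth changes
of variables `F : ℝᵐ → ℝⁿ`, i.e. `(P ∘ F)^*α = F^*(P^*α)`. If `X` is a smooth manifold with its
manifold diffeology, or an embedded submanifold with the subspace diffeology, this is the usual
space of differential forms. -/
def Form (X : Type u) [DiffeologicalSpace X] (p : ℕ) := ↥(formSubmodule X p)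

noncomputable instance (X : Type u) [DiffeologicalSpace X] (p : ℕ) : AddCommGroup (Form X p) :=
  inferInstanceAs (AddCommGroup ↥(formSubmodule X p))

noncomputable instance (X : Type u) [DiffeologicalSpace X] (p : ℕ) : Module ℝ (Form X p) :=
  inferInstanceAs (Module ℝ ↥(formSubmodule X p))

/-- The form `P^*α` on `ℝⁿ`, for a plot `P : ℝⁿ → X` and a form `α` on `X`. -/
def Form.on {X : Type u} [DiffeologicalSpace X] {p n : ℕ} (α : Form X p) (P : Plot X n) :
    EuclideanSpace ℝ (Fin n) → (EuclideanSpace ℝ (Fin n)) [⋀^Fin p]→L[ℝ] ℝ :=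
  α.1 n P

@[ext]
theorem Form.ext {X : Type u} [DiffeologicalSpace X] {p : ℕ} {α β : Form X p}
    (h : ∀ (n : ℕ) (P : Plot X n) x, α.on P x = β.on P x) : α = β :=
  Subtype.ext (funext fun n => funext fun P => funext fun x => h n P x)

/-- The pullback `f^* : Ω^p(Y) → Ω^p(X)` along a smooth map `f : X → Y`. -/
noncomputable def Form.pullback {X : Type u} {Y : Type v} [DiffeologicalSpace X] [DiffeologicalSpace Y]
    (f : X → Y) (hf : DSmooth f) (p : ℕ) : Form Y p →ₗ[ℝ] Form X p where
  toFun η := ⟨fun n P => η.1 n (P.push f hf),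
    ⟨fun n _ => η.2.1 n _, fun m n P F hF x => η.2.2 m n (P.push f hf) F hF x⟩⟩
  map_add' _ _ := rfl
  map_smul' _ _ := rfl

/-- The de Rham differential `d : Ω^p(X) → Ω^(p+1)(X)`. -/
noncomputable def Form.d {X : Type u} [DiffeologicalSpace X] (p : ℕ) :
    Form X p →ₗ[ℝ] Form X (p + 1) where
  toFun η := ⟨fun n P => extDeriv (η.1 n P),
    ⟨fun n P => by
      have h : ContDiff ℝ ∞ (fderiv ℝ (η.1 n P)) := (η.2.1 n P).fderiv_right (by simp)
      exact (ContinuousAlternatingMap.alternatizeUncurryFinCLM ℝ _ ℝ).contDiff.comp h,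
    fun m n P F hF x => by
      have h : η.1 m (P.reparam F hF) =
          fun x => (η.1 n P (F x)).compContinuousLinearMap (fderiv ℝ F x) :=
        funext fun x => η.2.2 m n P F hF x
      simp only [h]
      exact extDeriv_pullback (r := ∞) (((η.2.1 n P).differentiable (by simp)) _) hF.contDiffAt
        (by simp only [minSmoothness_of_isRCLikeNormedField]; exact WithTop.coe_le_coe.2 le_top)⟩⟩
  map_add' a b := by
    ext1 n P x
    exact extDeriv_add (((a.2.1 n P).differentiable (by simp)) _)
      (((b.2.1 n P).differentiable (by simp)) _)
  map_smul' c a := by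
    ext1 n P x
    exact extDeriv_smul c (a.1 n P)

end Forms

/-! ### Manifolds as diffeological spaces -/

section Manifolds

/-- The standard diffeology of a smooth `m`-dimensional manifold `M`: the plots are the smooth maps
`ℝⁿ → M`. -/
@[reducible]
def manifoldDiffeology (m : ℕ) (M : Type u) [TopologicalSpace M]
    [ChartedSpace (EuclideanSpace ℝ (Fin m)) M] : DiffeologicalSpace M where
  plots n := {P | ContMDiff (𝓡 n) (𝓡 m) ∞ P}
  constant_plots _ := contMDiff_const
  plot_reparam hp hf := ContMDiff.comp hp hf.contMDiff
  locality := by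
    intro n P hP x
    obtain ⟨U, hU, hx, h⟩ := hP x
    -- compose with a diffeomorphism of `ℝⁿ` onto a ball around `x` contained in `U`
    obtain ⟨r, hr, hrU⟩ := Metric.isOpen_iff.1 hU x hx
    have hF : ContDiff ℝ ∞ (OpenPartialHomeomorph.univBall x r) :=
      OpenPartialHomeomorph.contDiff_univBall
    have hc : ContMDiff (𝓡 n) (𝓡 m) ∞ (P ∘ OpenPartialHomeomorph.univBall x r) := by
      refine h (fun y => hrU ?_) hF
      have := (OpenPartialHomeomorph.univBall x r).map_source (x := y) (by simp)
      rwa [OpenPartialHomeomorph.univBall_target x hr] at this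
    have hs : ContDiffOn ℝ ∞ (OpenPartialHomeomorph.univBall x r).symm (Metric.ball x r) :=
      OpenPartialHomeomorph.contDiffOn_univBall_symm
    have hb : Metric.ball x r ∈ nhds x := Metric.ball_mem_nhds x hr
    have h2 : ContMDiffAt (𝓡 n) (𝓡 n) ∞ (OpenPartialHomeomorph.univBall x r).symm x :=
      (hs.contDiffAt hb).contMDiffAt
    have h3 := (hc ((OpenPartialHomeomorph.univBall x r).symm x)).comp x h2
    refine h3.congr_of_eventuallyEq ?_
    filter_upwards [hb] with y hy
    simp only [Function.comp_apply]
    rw [OpenPartialHomeomorph.right_inv]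
    rwa [OpenPartialHomeomorph.univBall_target x hr]

end Manifolds

/-! ### The angular form on the circle -/

section Angular

/-- The differential forms on an `m`-dimensional smooth manifold. -/
abbrev ManifoldForm (m : ℕ) (M : Type u) [TopologicalSpace M]
    [ChartedSpace (EuclideanSpace ℝ (Fin m)) M] (p : ℕ) :=
  @Form M (manifoldDiffeology m M) p

/-- For `P : ℝⁿ → ℂ`, the 1-form `Im (conj(P) dP)`. If `P = e^(iτ)`, this is `dτ`. -/
noncomputable def angularFun {n : ℕ} (P : EuclideanSpace ℝ (Fin n) → ℂ)
    (x : EuclideanSpace ℝ (Fin n)) : EuclideanSpace ℝ (Fin n) →L[ℝ] ℝ :=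
  Complex.imCLM.comp ((starRingEnd ℂ (P x)) • fderiv ℝ P x)

theorem angularFun_apply {n : ℕ} (P : EuclideanSpace ℝ (Fin n) → ℂ)
    (x v : EuclideanSpace ℝ (Fin n)) :
    angularFun P x v = ((starRingEnd ℂ (P x)) * fderiv ℝ P x v).im := rfl

theorem contDiff_angularFun {n : ℕ} {P : EuclideanSpace ℝ (Fin n) → ℂ} (hP : ContDiff ℝ ∞ P) :
    ContDiff ℝ ∞ (angularFun P) := by
  have h1 : ContDiff ℝ ∞ fun x => (starRingEnd ℂ (P x)) • fderiv ℝ P x :=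
    (Complex.conjCLE.contDiff.comp hP).smul (hP.fderiv_right (by simp))
  exact (ContinuousLinearMap.compL ℝ (EuclideanSpace ℝ (Fin n)) ℂ ℝ Complex.imCLM).contDiff.comp h1

theorem contDiff_coe_circle {n : ℕ} {P : EuclideanSpace ℝ (Fin n) → Circle}
    (hP : @IsPlot _ (manifoldDiffeology 1 Circle) n P) :
    ContDiff ℝ ∞ fun x => (P x : ℂ) := by
  have hP' : ContMDiff (𝓡 n) (𝓡 1) ∞ P := hP
  have hc : ContMDiff (𝓡 1) 𝓘(ℝ, ℂ) ∞ (fun z : Circle => (z : ℂ)) := by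
    have : Fact (Module.finrank ℝ ℂ = 1 + 1) := finrank_real_complex_fact'
    exact contMDiff_coe_sphere (E := ℂ) (n := 1) (m := ∞)
  exact (hc.comp hP').contDiff

/-- The angular (Maurer-Cartan) form `dt` on `S¹`: its pullback along a smooth map `P : ℝⁿ → S¹`
is `Im (conj(P) dP) = -i P⁻¹ dP`. -/
noncomputable def angularForm : ManifoldForm 1 Circle 1 :=
  ⟨fun n P x => ContinuousAlternatingMap.ofSubsingletonLIE (𝕜 := ℝ) (0 : Fin 1)
      (angularFun (fun y => ((P.1 y : Circle) : ℂ)) x), by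
    constructor
    · intro n P
      exact (LinearIsometryEquiv.contDiff _).comp (contDiff_angularFun (contDiff_coe_circle P.2))
    · intro m n P F hF x
      ext v
      have hd : DifferentiableAt ℝ (fun y => ((P.1 y : Circle) : ℂ)) (F x) :=
        (contDiff_coe_circle P.2).differentiable (by simp) _
      have hF' : DifferentiableAt ℝ F x := hF.differentiable (by simp) _
      have hc : fderiv ℝ (fun y => ((P.1 (F y) : Circle) : ℂ)) x =
          (fderiv ℝ (fun y => ((P.1 y : Circle) : ℂ)) (F x)).comp (fderiv ℝ F x) :=
        fderiv_comp x hd hF'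
      change angularFun (fun y => ((P.1 (F y) : Circle) : ℂ)) x (v 0) =
        angularFun (fun y => ((P.1 y : Circle) : ℂ)) (F x) (fderiv ℝ F x (v 0))
      rw [angularFun_apply, angularFun_apply, hc]
      rfl⟩

theorem angularForm_on {n : ℕ} (P : @Plot Circle (manifoldDiffeology 1 Circle) n)
    (x : EuclideanSpace ℝ (Fin n)) (v : Fin 1 → EuclideanSpace ℝ (Fin n)) :
    @Form.on Circle (manifoldDiffeology 1 Circle) 1 n angularForm P x v =
      angularFun (fun y => ((P.1 y : Circle) : ℂ)) x (v 0) := rfl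

/-- The angular form is closed. -/
theorem d_angularForm : @Form.d Circle (manifoldDiffeology 1 Circle) 1 angularForm = 0 := by
  let _ := manifoldDiffeology 1 Circle
  ext n P x v
  set p : EuclideanSpace ℝ (Fin n) → ℂ := fun y => ((P.1 y : Circle) : ℂ) with hp
  have hP : ContDiff ℝ ∞ p := contDiff_coe_circle P.2
  have hdp : DifferentiableAt ℝ p x := hP.differentiable (by simp) x
  have hD : ContDiff ℝ ∞ (fderiv ℝ p) := hP.fderiv_right (by simp)
  have hdD : DifferentiableAt ℝ (fderiv ℝ p) x := hD.differentiable (by simp) x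
  -- the derivative of `Im (conj p dp)`
  have key : ∀ a b : EuclideanSpace ℝ (Fin n),
      fderiv ℝ (fun y => angularFun p y a) x b =
        ((starRingEnd ℂ (fderiv ℝ p x b)) * fderiv ℝ p x a +
          (starRingEnd ℂ (p x)) * fderiv ℝ (fderiv ℝ p) x b a).im := by
    intro a b
    have h1 : HasFDerivAt (fun y => starRingEnd ℂ (p y))
        ((Complex.conjCLE : ℂ →L[ℝ] ℂ).comp (fderiv ℝ p x)) x :=
      (Complex.conjCLE : ℂ →L[ℝ] ℂ).hasFDerivAt.comp x hdp.hasFDerivAt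
    have h2 : HasFDerivAt (fun y => fderiv ℝ p y a) ((fderiv ℝ (fderiv ℝ p) x).flip a) x := by
      have := hdD.hasFDerivAt.clm_apply (hasFDerivAt_const a x)
      simpa using this
    have h3 := Complex.imCLM.hasFDerivAt.comp x (h1.mul h2)
    have h4 : (fun y => angularFun p y a) =
        (Complex.imCLM ∘ fun y => (starRingEnd ℂ (p y)) * fderiv ℝ p y a) := rfl
    have h5 := h3.fderiv
    rw [h4]
    refine (congrArg (fun L : EuclideanSpace ℝ (Fin n) →L[ℝ] ℝ => L b) h5).trans ?_
    simp
    ring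
  have hsymm : fderiv ℝ (fderiv ℝ p) x (v 0) (v 1) = fderiv ℝ (fderiv ℝ p) x (v 1) (v 0) :=
    (hP.contDiffAt.isSymmSndFDerivAt
      (by simp only [minSmoothness_of_isRCLikeNormedField]; exact WithTop.coe_le_coe.2 le_top)) _ _
  -- tangent vectors of the circle are perpendicular to the radius
  have horth : ∀ a, ((starRingEnd ℂ (p x)) * fderiv ℝ p x a).re = 0 := by
    intro a
    have h1 : HasFDerivAt (fun y => starRingEnd ℂ (p y))
        ((Complex.conjCLE : ℂ →L[ℝ] ℂ).comp (fderiv ℝ p x)) x :=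
      (Complex.conjCLE : ℂ →L[ℝ] ℂ).hasFDerivAt.comp x hdp.hasFDerivAt
    have h2 := h1.mul hdp.hasFDerivAt
    have h3 : (fun y => starRingEnd ℂ (p y)) * p = fun _ => (1 : ℂ) := by
      funext y
      simp [hp, ← Complex.normSq_eq_conj_mul_self]
    rw [h3] at h2
    have h4 := congrArg (fun L : EuclideanSpace ℝ (Fin n) →L[ℝ] ℂ => (L a).re)
      (h2.unique (hasFDerivAt_const (1 : ℂ) x))
    simp at h4 ⊢
    linarith
  have hone : (p x).re * (p x).re + (p x).im * (p x).im = 1 := by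
    have := Circle.normSq_coe (P.1 x)
    rwa [Complex.normSq_apply] at this
  have himp : ((starRingEnd ℂ (fderiv ℝ p x (v 0))) * fderiv ℝ p x (v 1)).im = 0 := by
    have h0 := horth (v 0)
    have h1 := horth (v 1)
    simp only [Complex.mul_re, Complex.mul_im, Complex.conj_re, Complex.conj_im] at h0 h1 ⊢
    set A := fderiv ℝ p x (v 0)
    set B := fderiv ℝ p x (v 1)
    set c := (p x).re
    set s := (p x).im
    have e : A.re * B.im + -A.im * B.re = (c * c + s * s) * (A.re * B.im + -A.im * B.re) := by
      rw [hone, _root_.one_mul]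
    rw [e]
    linear_combination (c * B.im - s * B.re) * h0 - (c * A.im - s * A.re) * h1
  have hdiff : DifferentiableAt ℝ (angularForm.on P) x :=
    (angularForm.2.1 n P).differentiable (by simp) x
  change extDeriv (angularForm.on P) x v = 0
  rw [extDeriv_apply hdiff, Fin.sum_univ_two]
  have f0 : (fun y => angularForm.on P y ((0 : Fin 2).removeNth v)) =
      fun y => angularFun p y (v 1) := by funext y; rw [angularForm_on]; rfl
  have f1 : (fun y => angularForm.on P y ((1 : Fin 2).removeNth v)) =
      fun y => angularFun p y (v 0) := by funext y; rw [angularForm_on]; rfl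
  rw [f0, f1, key, key, hsymm]
  have himp' : ((starRingEnd ℂ (fderiv ℝ p x (v 1))) * fderiv ℝ p x (v 0)).im = 0 := by
    simp only [Complex.mul_im, Complex.conj_re, Complex.conj_im] at himp ⊢
    linarith
  simp only [Complex.add_im, himp, himp']
  simp
  ring

end Angular

/-! ### Groupoids and 2-groupoids -/

/-- A groupoid with set of objects `Ob` and set of arrows `Arr`. The product `mul a b` is defined
when the source of `a` is the target of `b`. -/
structure GroupoidStr (Ob : Type u) (Arr : Type v) where
  /-- source -/
  s : Arr → Ob
  /-- target -/
  t : Arr → Ob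
  /-- partially defined multiplication -/
  mul : ∀ a b : Arr, s a = t b → Arr
  /-- units -/
  one : Ob → Arr
  /-- inverses -/
  inv : Arr → Arr
  s_mul : ∀ a b h, s (mul a b h) = s b
  t_mul : ∀ a b h, t (mul a b h) = t a
  s_one : ∀ x, s (one x) = x
  t_one : ∀ x, t (one x) = x
  s_inv : ∀ a, s (inv a) = t a
  t_inv : ∀ a, t (inv a) = s a
  mul_assoc : ∀ a b c (hab : s a = t b) (hbc : s b = t c),
    mul (mul a b hab) c ((s_mul a b hab).trans hbc) =
      mul a (mul b c hbc) (hab.trans (t_mul b c hbc).symm)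
  one_mul : ∀ a, mul (one (t a)) a (s_one (t a)) = a
  mul_one : ∀ a, mul a (one (s a)) (t_one (s a)).symm = a
  inv_mul : ∀ a, mul (inv a) a (s_inv a) = one (s a)
  mul_inv : ∀ a, mul a (inv a) (t_inv a).symm = one (t a)

/-- The structure maps of a groupoid are smooth. The multiplication is smooth on the fibre product
`{(a, b) | s a = t b}`, endowed with the subspace diffeology of the product. -/
structure GroupoidStr.IsSmooth {Ob : Type u} {Arr : Type v} [DiffeologicalSpace Ob]
    [DiffeologicalSpace Arr] (G : GroupoidStr Ob Arr) : Prop where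
  smooth_s : DSmooth G.s
  smooth_t : DSmooth G.t
  smooth_one : DSmooth G.one
  smooth_inv : DSmooth G.inv
  smooth_mul : ∀ (n : ℕ) (P Q : EuclideanSpace ℝ (Fin n) → Arr) (h : ∀ x, G.s (P x) = G.t (Q x)),
    IsPlot P → IsPlot Q → IsPlot fun x => G.mul (P x) (Q x) (h x)

/-- A (strict) smooth 2-groupoid `Γ₂ ⇉ Γ₁ ⇉ Γ₀`, presented as a double groupoid whose right
column is the trivial groupoid on `Γ₀`. The spaces are diffeological spaces; Lie 2-groupoids are
those for which the spaces are manifolds and the sources and targets are submersions. -/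
structure TwoGroupoid where
  /-- objects -/
  Ob : Type u
  /-- 1-arrows -/
  One : Type v
  /-- 2-arrows -/
  Two : Type w
  diffOb : DiffeologicalSpace Ob
  diffOne : DiffeologicalSpace One
  diffTwo : DiffeologicalSpace Two
  /-- the groupoid `Γ₁ ⇉ Γ₀` -/
  hor : GroupoidStr Ob One
  /-- the groupoid `Γ₂ ⇉ Γ₁` with multiplication the vertical composition `⋆`. Its source
  is called `l` and its target is called `u`, so that `α ⋆ β` is defined when `l α = u β` -/
  ver : GroupoidStr One Two
  /-- the groupoid `Γ₂ ⇉ Γ₀` with multiplication the horizontal composition `*` -/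
  hor₂ : GroupoidStr Ob Two
  smooth_hor : hor.IsSmooth
  smooth_ver : ver.IsSmooth
  smooth_hor₂ : hor₂.IsSmooth
  s_l : ∀ α, hor.s (ver.s α) = hor₂.s α
  s_u : ∀ α, hor.s (ver.t α) = hor₂.s α
  t_l : ∀ α, hor.t (ver.s α) = hor₂.t α
  t_u : ∀ α, hor.t (ver.t α) = hor₂.t α
  l_hmul : ∀ α β h, ver.s (hor₂.mul α β h) =
    hor.mul (ver.s α) (ver.s β) ((s_l α).trans (h.trans (t_l β).symm))
  u_hmul : ∀ α β h, ver.t (hor₂.mul α β h) =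
    hor.mul (ver.t α) (ver.t β) ((s_u α).trans (h.trans (t_u β).symm))
  l_hone : ∀ x, ver.s (hor₂.one x) = hor.one x
  u_hone : ∀ x, ver.t (hor₂.one x) = hor.one x
  vone_mul : ∀ a b (h : hor.s a = hor.t b)
    (h' : hor₂.s (ver.one a) = hor₂.t (ver.one b)),
    ver.one (hor.mul a b h) = hor₂.mul (ver.one a) (ver.one b) h'
  vone_one : ∀ x, ver.one (hor.one x) = hor₂.one x
  /-- `(α ⋆ α') * (β ⋆ β') = (α * β) ⋆ (α' * β')` -/
  interchange : ∀ α α' β β' (hα : ver.s α = ver.t α') (hβ : ver.s β = ver.t β')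
    (h : hor₂.s α = hor₂.t β) (h' : hor₂.s α' = hor₂.t β')
    (k : hor₂.s (ver.mul α α' hα) = hor₂.t (ver.mul β β' hβ))
    (k' : ver.s (hor₂.mul α β h) = ver.t (hor₂.mul α' β' h')),
    hor₂.mul (ver.mul α α' hα) (ver.mul β β' hβ) k =
      ver.mul (hor₂.mul α β h) (hor₂.mul α' β' h') k'

attribute [instance] TwoGroupoid.diffOb TwoGroupoid.diffOne TwoGroupoid.diffTwo

/-- The maps `f₀` on objects and `f₁` on arrows form a functor between groupoids. -/
structure GroupoidStr.IsFunctor {Ob Ob' Arr Arr' : Type*} (G : GroupoidStr Ob Arr)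
    (G' : GroupoidStr Ob' Arr') (f₀ : Ob → Ob') (f₁ : Arr → Arr') : Prop where
  map_s : ∀ a, G'.s (f₁ a) = f₀ (G.s a)
  map_t : ∀ a, G'.t (f₁ a) = f₀ (G.t a)
  map_one : ∀ x, f₁ (G.one x) = G'.one (f₀ x)
  map_inv : ∀ a, f₁ (G.inv a) = G'.inv (f₁ a)
  map_mul : ∀ a b (h : G.s a = G.t b) (h' : G'.s (f₁ a) = G'.t (f₁ b)),
    f₁ (G.mul a b h) = G'.mul (f₁ a) (f₁ b) h'

/-- A (strict) morphism of smooth 2-groupoids: three smooth maps that commute with all structure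
maps. -/
structure TwoGroupoid.Hom (G : TwoGroupoid.{u, v, w})
    (H : TwoGroupoid.{u', v', w'}) where
  f₀ : G.Ob → H.Ob
  f₁ : G.One → H.One
  f₂ : G.Two → H.Two
  smooth₀ : DSmooth f₀
  smooth₁ : DSmooth f₁
  smooth₂ : DSmooth f₂
  hor : G.hor.IsFunctor H.hor f₀ f₁
  ver : G.ver.IsFunctor H.ver f₁ f₂
  hor₂ : G.hor₂.IsFunctor H.hor₂ f₀ f₂

/-! ### The nerve -/

/-- A `q`-simplex of the geometric nerve of `G`: objects `A_i`, 1-arrows `g_ij : A_i → A_j` for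
`i < j` and 2-arrows `α_ijk` from `u α_ijk = g_jk g_ij` to `l α_ijk = g_ik` for `i < j < k`, such
that each tetrahedron `i < j < k < l` commutes:
`(g_kl * α_ijk) ⋆ α_ikl = (α_jkl * g_ij) ⋆ α_ijl`. (In `tetra` the
proofs of composability are quantified over; they follow from the preceding fields.) -/
@[ext]
structure TwoGroupoid.Nerve (G : TwoGroupoid.{u, v, w}) (q : ℕ) where
  vertex : Fin (q + 1) → G.Ob
  edge : ∀ i j : Fin (q + 1), i < j → G.One
  tri : ∀ i j k : Fin (q + 1), i < j → j < k → G.Two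
  s_edge : ∀ i j h, G.hor.s (edge i j h) = vertex i
  t_edge : ∀ i j h, G.hor.t (edge i j h) = vertex j
  u_tri : ∀ i j k (hij : i < j) (hjk : j < k), G.ver.t (tri i j k hij hjk) =
    G.hor.mul (edge j k hjk) (edge i j hij) ((s_edge j k hjk).trans (t_edge i j hij).symm)
  l_tri : ∀ i j k (hij : i < j) (hjk : j < k),
    G.ver.s (tri i j k hij hjk) = edge i k (hij.trans hjk)
  tetra : ∀ i j k l (hij : i < j) (hjk : j < k) (hkl : k < l)
    (c₁ : G.hor₂.s (G.ver.one (edge k l hkl)) = G.hor₂.t (tri i j k hij hjk))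
    (c₂ : G.ver.s (G.hor₂.mul (G.ver.one (edge k l hkl)) (tri i j k hij hjk) c₁) =
      G.ver.t (tri i k l (hij.trans hjk) hkl))
    (c₃ : G.hor₂.s (tri j k l hjk hkl) = G.hor₂.t (G.ver.one (edge i j hij)))
    (c₄ : G.ver.s (G.hor₂.mul (tri j k l hjk hkl) (G.ver.one (edge i j hij)) c₃) =
      G.ver.t (tri i j l hij (hjk.trans hkl))),
    G.ver.mul (G.hor₂.mul (G.ver.one (edge k l hkl)) (tri i j k hij hjk) c₁)
        (tri i k l (hij.trans hjk) hkl) c₂ =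
      G.ver.mul (G.hor₂.mul (tri j k l hjk hkl) (G.ver.one (edge i j hij)) c₃)
        (tri i j l hij (hjk.trans hkl)) c₄

namespace TwoGroupoid

section Nerve

variable (G : TwoGroupoid.{u, v, w})

/-- The nerve `N_q G` carries the subspace diffeology of the product of the spaces of its vertices,
edges and triangles. -/
instance (q : ℕ) : DiffeologicalSpace (G.Nerve q) where
  plots n := {P | (∀ i, IsPlot fun x => (P x).vertex i) ∧
    (∀ i j h, IsPlot fun x => (P x).edge i j h) ∧
    (∀ i j k hij hjk, IsPlot fun x => (P x).tri i j k hij hjk)}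
  constant_plots _ := ⟨fun _ => isPlot_const, fun _ _ _ => isPlot_const,
    fun _ _ _ _ _ => isPlot_const⟩
  plot_reparam hp hf := ⟨fun i => isPlot_reparam (hp.1 i) hf,
    fun i j h => isPlot_reparam (hp.2.1 i j h) hf,
    fun i j k hij hjk => isPlot_reparam (hp.2.2 i j k hij hjk) hf⟩
  locality := by
    intro n P hP
    refine ⟨fun i => ?_, fun i j h => ?_, fun i j k hij hjk => ?_⟩
    all_goals
      refine DiffeologicalSpace.locality fun x => ?_
      obtain ⟨U, hU, hx, H⟩ := hP x
      refine ⟨U, hU, hx, fun hf hf' => ?_⟩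
    · exact (H hf hf').1 i
    · exact (H hf hf').2.1 i j h
    · exact (H hf hf').2.2 i j k hij hjk

variable {G}

/-- The face map `d_r : N_(q+1) G → N_q G`, which omits the `r`-th vertex. -/
def face {q : ℕ} (r : Fin (q + 2)) (x : G.Nerve (q + 1)) : G.Nerve q where
  vertex i := x.vertex (r.succAbove i)
  edge i j h := x.edge (r.succAbove i) (r.succAbove j) (Fin.succAbove_lt_succAbove_iff.2 h)
  tri i j k hij hjk := x.tri (r.succAbove i) (r.succAbove j) (r.succAbove k)
    (Fin.succAbove_lt_succAbove_iff.2 hij) (Fin.succAbove_lt_succAbove_iff.2 hjk)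
  s_edge _ _ _ := x.s_edge _ _ _
  t_edge _ _ _ := x.t_edge _ _ _
  u_tri _ _ _ _ _ := x.u_tri _ _ _ _ _
  l_tri _ _ _ _ _ := x.l_tri _ _ _ _ _
  tetra _ _ _ _ _ _ _ := x.tetra _ _ _ _ _ _ _

theorem dSmooth_face {q : ℕ} (r : Fin (q + 2)) : DSmooth (face r : G.Nerve (q + 1) → G.Nerve q) :=
  fun _ _ hP => ⟨fun _ => hP.1 _, fun _ _ _ => hP.2.1 _ _ _, fun _ _ _ _ _ => hP.2.2 _ _ _ _ _⟩

end Nerve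

section Cohomology

variable (G : TwoGroupoid.{u, v, w})

/-- The simplicial differential `∂ = (-1)^p ∑_r (-1)^r d_r^* : Ω^p(N_q G) → Ω^p(N_(q+1) G)`. -/
noncomputable def simpD (p q : ℕ) : Form (G.Nerve q) p →ₗ[ℝ] Form (G.Nerve (q + 1)) p :=
  (-1 : ℝ) ^ p • ∑ r : Fin (q + 2), (-1 : ℝ) ^ (r : ℕ) • Form.pullback (face (G := G) r) (dSmooth_face r) p

/-- The space `⨁_(p+q=n) Ω^p(N_q G)` of total degree `n` in the double complex. The
components are indexed by the pairs `(p, q)` with `p + q = n`. -/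
abbrev TotalForm (n : ℕ) := ∀ a : {a : ℕ × ℕ // a.1 + a.2 = n}, Form (G.Nerve a.1.2) a.1.1

variable {G}

/-- The de Rham part of the total differential. -/
noncomputable def totalDR {n : ℕ} (c : G.TotalForm n) : G.TotalForm (n + 1)
  | ⟨(0, _), _⟩ => 0
  | ⟨(p + 1, q), h⟩ => Form.d p (c ⟨(p, q), by dsimp only at h ⊢; omega⟩)

/-- The simplicial part of the total differential. -/
noncomputable def totalSimp {n : ℕ} (c : G.TotalForm n) : G.TotalForm (n + 1)
  | ⟨(_, 0), _⟩ => 0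
  | ⟨(p, q + 1), h⟩ => G.simpD p q (c ⟨(p, q), by dsimp only at h ⊢; omega⟩)

variable (G)

/-- The total differential `d + ∂`. -/
noncomputable def totalD (n : ℕ) : G.TotalForm n →ₗ[ℝ] G.TotalForm (n + 1) where
  toFun c := totalDR c + totalSimp c
  map_add' a b := by
    funext ⟨⟨p, q⟩, h⟩
    rcases p with _ | p <;> rcases q with _ | q <;>
      (simp [totalDR, totalSimp]; try abel)
  map_smul' r a := by
    funext ⟨⟨p, q⟩, h⟩
    rcases p with _ | p <;> rcases q with _ | q <;>
      simp [totalDR, totalSimp]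

/-- Cocycles of degree `n` of the total complex. -/
noncomputable def cocycles (n : ℕ) : Submodule ℝ (G.TotalForm n) := LinearMap.ker (G.totalD n)

/-- Coboundaries of degree `n` of the total complex. -/
noncomputable def coboundaries : ∀ n : ℕ, Submodule ℝ (G.TotalForm n)
  | 0 => ⊥
  | n + 1 => LinearMap.range (G.totalD n)

/-- The de Rham cohomology `H^n(G)` of a 2-groupoid. -/
abbrev Cohomology (n : ℕ) := G.cocycles n ⧸ (G.coboundaries n).submoduleOf (G.cocycles n)

/-- The cohomology class of a cocycle. -/
noncomputable def cohomologyClass {n : ℕ} (c : G.cocycles n) : G.Cohomology n := Submodule.Quotient.mk c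

end Cohomology

end TwoGroupoid

namespace TwoGroupoid.Hom

variable {G : TwoGroupoid.{u, v, w}} {H : TwoGroupoid.{u', v', w'}} (F : G.Hom H)

/-- The map induced by a morphism of 2-groupoids on nerves. -/
def nerve (q : ℕ) (x : G.Nerve q) : H.Nerve q where
  vertex i := F.f₀ (x.vertex i)
  edge i j h := F.f₁ (x.edge i j h)
  tri i j k hij hjk := F.f₂ (x.tri i j k hij hjk)
  s_edge i j h := by rw [F.hor.map_s, x.s_edge]
  t_edge i j h := by rw [F.hor.map_t, x.t_edge]
  u_tri i j k hij hjk := by rw [F.ver.map_t, x.u_tri]; exact F.hor.map_mul _ _ _ _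
  l_tri i j k hij hjk := by rw [F.ver.map_s, x.l_tri]
  tetra i j k l hij hjk hkl c₁ c₂ c₃ c₄ := by
    have d₁ : G.hor₂.s (G.ver.one (x.edge k l hkl)) = G.hor₂.t (x.tri i j k hij hjk) := by
      rw [← G.s_l, ← G.t_l, G.ver.s_one, x.s_edge, x.l_tri, x.t_edge]
    have d₂ : G.ver.s (G.hor₂.mul (G.ver.one (x.edge k l hkl)) (x.tri i j k hij hjk) d₁) =
        G.ver.t (x.tri i k l (hij.trans hjk) hkl) := by
      simp only [G.l_hmul, x.u_tri, x.l_tri, G.ver.s_one]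
    have d₃ : G.hor₂.s (x.tri j k l hjk hkl) = G.hor₂.t (G.ver.one (x.edge i j hij)) := by
      rw [← G.s_l, ← G.t_l, G.ver.s_one, x.t_edge, x.l_tri, x.s_edge]
    have d₄ : G.ver.s (G.hor₂.mul (x.tri j k l hjk hkl) (G.ver.one (x.edge i j hij)) d₃) =
        G.ver.t (x.tri i j l hij (hjk.trans hkl)) := by
      simp only [G.l_hmul, x.u_tri, x.l_tri, G.ver.s_one]
    have e₁ : H.hor₂.s (F.f₂ (G.ver.one (x.edge k l hkl))) =
        H.hor₂.t (F.f₂ (x.tri i j k hij hjk)) := by rw [F.ver.map_one]; exact c₁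
    have e₃ : H.hor₂.s (F.f₂ (x.tri j k l hjk hkl)) =
        H.hor₂.t (F.f₂ (G.ver.one (x.edge i j hij))) := by rw [F.ver.map_one]; exact c₃
    have m₁ := F.hor₂.map_mul _ _ d₁ e₁
    have m₃ := F.hor₂.map_mul _ _ d₃ e₃
    simp only [F.ver.map_one] at m₁ m₃
    have main := congrArg F.f₂ (x.tetra i j k l hij hjk hkl d₁ d₂ d₃ d₄)
    have e₂ : H.ver.s (F.f₂ (G.hor₂.mul (G.ver.one (x.edge k l hkl)) (x.tri i j k hij hjk) d₁)) =
        H.ver.t (F.f₂ (x.tri i k l (hij.trans hjk) hkl)) := by rw [m₁]; exact c₂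
    have e₄ : H.ver.s (F.f₂ (G.hor₂.mul (x.tri j k l hjk hkl) (G.ver.one (x.edge i j hij)) d₃)) =
        H.ver.t (F.f₂ (x.tri i j l hij (hjk.trans hkl))) := by rw [m₃]; exact c₄
    rw [F.ver.map_mul _ _ d₂ e₂, F.ver.map_mul _ _ d₄ e₄] at main
    simp only [m₁, m₃] at main
    exact main

theorem dSmooth_nerve (q : ℕ) : DSmooth (F.nerve q) :=
  fun _ _ hP => ⟨fun _ => (hP.1 _).dSmooth_comp F.smooth₀,
    fun _ _ _ => (hP.2.1 _ _ _).dSmooth_comp F.smooth₁,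
    fun _ _ _ _ _ => (hP.2.2 _ _ _ _ _).dSmooth_comp F.smooth₂⟩

/-- The pullback of cochains of the total complex. -/
noncomputable def pullback (n : ℕ) : H.TotalForm n →ₗ[ℝ] G.TotalForm n where
  toFun c a := Form.pullback (F.nerve a.1.2) (F.dSmooth_nerve a.1.2) a.1.1 (c a)
  map_add' a b := by funext i; simp
  map_smul' r a := by funext i; simp

theorem pullback_totalD (n : ℕ) (c : H.TotalForm n) :
    F.pullback (n + 1) (H.totalD n c) = G.totalD n (F.pullback n c) := by
  have hs : ∀ p q (a : Form (H.Nerve q) p),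
      Form.pullback (F.nerve (q + 1)) (F.dSmooth_nerve (q + 1)) p (H.simpD p q a) =
        G.simpD p q (Form.pullback (F.nerve q) (F.dSmooth_nerve q) p a) := by
    intro p q a
    simp only [simpD, LinearMap.smul_apply, LinearMap.sum_apply, map_smul, map_sum]
    rfl
  funext ⟨⟨p, q⟩, h⟩
  rcases p with _ | p <;> rcases q with _ | q
  · omega
  · simp [pullback, totalD, totalDR, totalSimp, hs]
  · simp [pullback, totalD, totalDR, totalSimp]
    rfl
  · simp [pullback, totalD, totalDR, totalSimp, hs]
    rfl

/-- The pullback of cocycles. -/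
noncomputable def pullbackCocycles (n : ℕ) : H.cocycles n →ₗ[ℝ] G.cocycles n :=
  (F.pullback n).restrict fun c hc => by
    have hc' : H.totalD n c = 0 := hc
    change G.totalD n (F.pullback n c) = 0
    rw [← F.pullback_totalD, hc', map_zero]

/-- The pullback `F^* : H^n(H) → H^n(G)` in cohomology. -/
noncomputable def cohomologyMap (n : ℕ) : H.Cohomology n →ₗ[ℝ] G.Cohomology n :=
  Submodule.mapQ _ _ (F.pullbackCocycles n) fun c hc => by
    rcases n with _ | n
    · have h0 : (c : H.TotalForm 0) = 0 := hc
      change F.pullback 0 (c : H.TotalForm 0) = 0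
      rw [h0, map_zero]
    · obtain ⟨b, hb⟩ : ∃ b, H.totalD n b = (c : H.TotalForm (n + 1)) := hc
      exact ⟨F.pullback n b, by rw [← F.pullback_totalD, hb]; rfl⟩

end TwoGroupoid.Hom

namespace TwoGroupoid

variable (G : TwoGroupoid.{u, v, w})

theorem dSmooth_edge (q : ℕ) (i j : Fin (q + 1)) (h : i < j) :
    DSmooth (fun x : G.Nerve q => x.edge i j h) :=
  fun _ _ hP => hP.2.1 i j h

theorem dSmooth_tri (q : ℕ) (i j k : Fin (q + 1)) (hij : i < j) (hjk : j < k) :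
    DSmooth (fun x : G.Nerve q => x.tri i j k hij hjk) :=
  fun _ _ hP => hP.2.2 i j k hij hjk

/-- A 1-form on `Γ₁ = N_1 G`, as a cochain of total degree `2`. -/
noncomputable def ofOneArrows (θ : Form G.One 1) : G.TotalForm 2
  | ⟨(1, 1), _⟩ => Form.pullback (fun x : G.Nerve 1 => x.edge 0 1 (by decide))
      (G.dSmooth_edge 1 0 1 (by decide)) 1 θ
  | _ => 0

/-- The pullback to `N_2 G` of a 1-form on `Γ₂` along the map that sends a triangle to the 2-arrow
that fills it, as a cochain of total degree `3`. -/
noncomputable def ofTwoArrows (α : Form G.Two 1) : G.TotalForm 3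
  | ⟨(1, 2), _⟩ => Form.pullback (fun x : G.Nerve 2 => x.tri 0 1 2 (by decide) (by decide))
      (G.dSmooth_tri 2 0 1 2 (by decide) (by decide)) 1 α
  | _ => 0

end TwoGroupoid

/-! ### Some 2-groupoids -/

namespace GroupoidStr

/-- The groupoid on `X` with only identity arrows. -/
def discrete (X : Type u) : GroupoidStr X X where
  s := id
  t := id
  mul a _ _ := a
  one := id
  inv := id
  s_mul _ _ h := h
  t_mul _ _ _ := rfl
  s_one _ := rfl
  t_one _ := rfl
  s_inv _ := rfl
  t_inv _ := rfl
  mul_assoc _ _ _ _ _ := rfl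
  one_mul _ := rfl
  mul_one _ := rfl
  inv_mul _ := rfl
  mul_inv _ := rfl

theorem discrete_isSmooth (X : Type u) [DiffeologicalSpace X] : (discrete X).IsSmooth where
  smooth_s := dSmooth_id
  smooth_t := dSmooth_id
  smooth_one := dSmooth_id
  smooth_inv := dSmooth_id
  smooth_mul _ _ _ _ hP _ := hP

/-- The trivial bundle of groups `M × K ⇉ M`. -/
def groupBundle (M : Type u) (K : Type v) [Group K] : GroupoidStr M (M × K) where
  s a := a.1
  t a := a.1
  mul a b _ := (a.1, a.2 * b.2)
  one x := (x, 1)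
  inv a := (a.1, a.2⁻¹)
  s_mul _ _ h := h
  t_mul _ _ _ := rfl
  s_one _ := rfl
  t_one _ := rfl
  s_inv _ := rfl
  t_inv _ := rfl
  mul_assoc _ _ _ _ _ := by simp [_root_.mul_assoc]
  one_mul _ := by simp
  mul_one _ := by simp
  inv_mul _ := by simp
  mul_inv _ := by simp

/-- A group as a groupoid with one object. -/
def ofGroup (K : Type v) [Group K] : GroupoidStr Unit K where
  s _ := ()
  t _ := ()
  mul a b _ := a * b
  one _ := 1
  inv a := a⁻¹
  s_mul _ _ _ := rfl
  t_mul _ _ _ := rfl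
  s_one _ := rfl
  t_one _ := rfl
  s_inv _ := rfl
  t_inv _ := rfl
  mul_assoc _ _ _ _ _ := _root_.mul_assoc _ _ _
  one_mul _ := _root_.one_mul _
  mul_one _ := _root_.mul_one _
  inv_mul _ := inv_mul_cancel _
  mul_inv _ := mul_inv_cancel _

end GroupoidStr

/-- The diffeology of the one-point manifold. -/
@[reducible]
def pointDiffeology : DiffeologicalSpace Unit where
  plots _ := Set.univ
  constant_plots _ := trivial
  plot_reparam _ _ := trivial
  locality _ := trivial

section Circle

theorem circle_isSmooth :
    @GroupoidStr.IsSmooth Unit Circle pointDiffeology (manifoldDiffeology 1 Circle)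
      (GroupoidStr.ofGroup Circle) := by
  let _ := pointDiffeology
  let _ := manifoldDiffeology 1 Circle
  have : LieGroup (𝓡 1) ∞ Circle := LieGroup.of_le (n := ω) le_top
  refine ⟨fun _ _ _ => trivial, fun _ _ _ => trivial, fun _ _ _ => isPlot_const, ?_, ?_⟩
  · intro n P hP
    have hP' : ContMDiff (𝓡 n) (𝓡 1) ∞ P := hP
    exact hP'.inv
  · intro n P Q _ hP hQ
    have hP' : ContMDiff (𝓡 n) (𝓡 1) ∞ P := hP
    have hQ' : ContMDiff (𝓡 n) (𝓡 1) ∞ Q := hQ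
    exact hP'.mul hQ'

/-- The Lie 2-group `[S¹ → 1]`, i.e. `S¹ ⇉ * ⇉ *`; both compositions are the multiplication
of `S¹`. -/
@[reducible]
noncomputable def circleTwoGroup : TwoGroupoid.{0, 0, 0} where
  Ob := Unit
  One := Unit
  Two := Circle
  diffOb := pointDiffeology
  diffOne := pointDiffeology
  diffTwo := manifoldDiffeology 1 Circle
  hor := GroupoidStr.discrete Unit
  ver := GroupoidStr.ofGroup Circle
  hor₂ := GroupoidStr.ofGroup Circle
  smooth_hor := @GroupoidStr.discrete_isSmooth Unit pointDiffeology
  smooth_ver := circle_isSmooth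
  smooth_hor₂ := circle_isSmooth
  s_l _ := rfl
  s_u _ := rfl
  t_l _ := rfl
  t_u _ := rfl
  l_hmul _ _ _ := rfl
  u_hmul _ _ _ := rfl
  l_hone _ := rfl
  u_hone _ := rfl
  vone_mul _ _ _ _ := (mul_one (1 : Circle)).symm
  vone_one _ := rfl
  interchange a a' b b' _ _ _ _ _ _ := mul_mul_mul_comm (a : Circle) a' b b'

end Circle

section AngularCocycle

theorem angularFun_mul {n : ℕ} {P Q : EuclideanSpace ℝ (Fin n) → Circle}
    (hP : ContDiff ℝ ∞ fun x => (P x : ℂ)) (hQ : ContDiff ℝ ∞ fun x => (Q x : ℂ))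
    (x : EuclideanSpace ℝ (Fin n)) :
    angularFun (fun y => ((P y * Q y : Circle) : ℂ)) x =
      angularFun (fun y => (P y : ℂ)) x + angularFun (fun y => (Q y : ℂ)) x := by
  ext v
  have h := ((hP.differentiable (by simp) x).hasFDerivAt.mul
    (hQ.differentiable (by simp) x).hasFDerivAt).fderiv
  have h' : fderiv ℝ (fun y => ((P y * Q y : Circle) : ℂ)) x v =
      (P x : ℂ) * fderiv ℝ (fun y => (Q y : ℂ)) x v +
        (Q x : ℂ) * fderiv ℝ (fun y => (P y : ℂ)) x v :=
    congrArg (fun L : EuclideanSpace ℝ (Fin n) →L[ℝ] ℂ => L v) h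
  have hp : (starRingEnd ℂ (P x : ℂ)) * (P x : ℂ) = 1 := by
    rw [← Complex.normSq_eq_conj_mul_self, Circle.normSq_coe, Complex.ofReal_one]
  have hq : (starRingEnd ℂ (Q x : ℂ)) * (Q x : ℂ) = 1 := by
    rw [← Complex.normSq_eq_conj_mul_self, Circle.normSq_coe, Complex.ofReal_one]
  rw [_root_.add_apply, angularFun_apply, angularFun_apply, angularFun_apply, h',
    ← Complex.add_im, Circle.coe_mul, map_mul]
  congr 1
  linear_combination
    ((starRingEnd ℂ (Q x : ℂ)) * fderiv ℝ (fun y => (Q y : ℂ)) x v) * hp +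
      ((starRingEnd ℂ (P x : ℂ)) * fderiv ℝ (fun y => (P y : ℂ)) x v) * hq

/-- The angular form on `N_2 [S¹ → 1] = S¹` is a cocycle: `d(dt) = 0` and `∂(dt) = 0`. -/
theorem angular_totalD :
    circleTwoGroup.totalD 3 (circleTwoGroup.ofTwoArrows angularForm) = 0 := by
  have hd : Form.d 1 (circleTwoGroup.ofTwoArrows angularForm ⟨(1, 2), rfl⟩) = 0 := by
    let _ : DiffeologicalSpace circleTwoGroup.Two := circleTwoGroup.diffTwo
    have h := congrArg (Form.pullback
      (fun x : circleTwoGroup.Nerve 2 => x.tri 0 1 2 (by decide) (by decide))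
      (circleTwoGroup.dSmooth_tri 2 0 1 2 (by decide) (by decide)) 2) d_angularForm
    rw [map_zero] at h
    exact h
  have hs : circleTwoGroup.simpD 1 2 (circleTwoGroup.ofTwoArrows angularForm ⟨(1, 2), rfl⟩) = 0 := by
    ext n P x v
    have T : ∀ (y : EuclideanSpace ℝ (Fin n)),
        ((P.1 y).tri 0 1 2 (by decide) (by decide) : Circle) *
          (P.1 y).tri 0 2 3 (by decide) (by decide) =
        (P.1 y).tri 1 2 3 (by decide) (by decide) * (P.1 y).tri 0 1 3 (by decide) (by decide) := by
      intro y
      have h := (P.1 y).tetra 0 1 2 3 (by decide) (by decide) (by decide) rfl rfl rfl rfl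
      change ((1 : Circle) * _) * _ = (_ * (1 : Circle)) * _ at h
      rwa [_root_.one_mul, _root_.mul_one] at h
    have S : ∀ (i j k : Fin 4) (hij : i < j) (hjk : j < k),
        ContDiff ℝ ∞ fun y => (((P.1 y).tri i j k hij hjk : Circle) : ℂ) :=
      fun i j k hij hjk => contDiff_coe_circle (P.2.2.2 i j k hij hjk)
    have e1 := angularFun_mul (S 0 1 2 (by decide) (by decide)) (S 0 2 3 (by decide) (by decide)) x
    have e2 := angularFun_mul (S 1 2 3 (by decide) (by decide)) (S 0 1 3 (by decide) (by decide)) x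
    simp only [T] at e1
    have e := congrArg (fun L : EuclideanSpace ℝ (Fin n) →L[ℝ] ℝ => L (v 0)) (e1.symm.trans e2)
    simp only [_root_.add_apply] at e
    rw [TwoGroupoid.simpD, Fin.sum_univ_four]
    change (-1 : ℝ) ^ 1 * ((-1 : ℝ) ^ 0 * angularFun _ x (v 0) + (-1 : ℝ) ^ 1 * angularFun _ x (v 0)
      + (-1 : ℝ) ^ 2 * angularFun _ x (v 0) + (-1 : ℝ) ^ 3 * angularFun _ x (v 0)) = 0
    refine Eq.trans ?_ (sub_eq_zero.2 e)
    change (-1 : ℝ) ^ 1 * ((-1 : ℝ) ^ 0 *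
        angularFun (fun y => (((P.1 y).tri 1 2 3 (by decide) (by decide) : Circle) : ℂ)) x (v 0)
      + (-1 : ℝ) ^ 1 *
        angularFun (fun y => (((P.1 y).tri 0 2 3 (by decide) (by decide) : Circle) : ℂ)) x (v 0)
      + (-1 : ℝ) ^ 2 *
        angularFun (fun y => (((P.1 y).tri 0 1 3 (by decide) (by decide) : Circle) : ℂ)) x (v 0)
      + (-1 : ℝ) ^ 3 *
        angularFun (fun y => (((P.1 y).tri 0 1 2 (by decide) (by decide) : Circle) : ℂ)) x (v 0))
      = _
    ring
  funext ⟨⟨p, q⟩, h⟩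
  have h' : p + q = 4 := h
  obtain ⟨rfl, rfl⟩ | ⟨rfl, rfl⟩ | ⟨rfl, rfl⟩ | ⟨rfl, rfl⟩ | ⟨rfl, rfl⟩ :
      (p = 0 ∧ q = 4) ∨ (p = 1 ∧ q = 3) ∨ (p = 2 ∧ q = 2) ∨ (p = 3 ∧ q = 1) ∨ (p = 4 ∧ q = 0) := by
    omega
  · change (0 : Form _ 0) + circleTwoGroup.simpD 0 3 0 = 0
    rw [map_zero, add_zero]
  · change Form.d 0 (0 : Form _ 0) + circleTwoGroup.simpD 1 2 _ = 0
    rw [hs, map_zero, add_zero]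
  · change Form.d 1 _ + circleTwoGroup.simpD 2 1 0 = 0
    rw [hd, map_zero, add_zero]
  · change Form.d 2 (0 : Form _ 2) + circleTwoGroup.simpD 3 0 0 = 0
    rw [map_zero, map_zero, add_zero]
  · change Form.d 3 (0 : Form _ 3) + 0 = 0
    rw [map_zero, add_zero]

/-- The angular form `dt ∈ Ω¹(N_2 [S¹ → 1])`, as a cocycle of total degree `3`. -/
noncomputable def angularCocycle : circleTwoGroup.cocycles 3 :=
  ⟨circleTwoGroup.ofTwoArrows angularForm, angular_totalD⟩

end AngularCocycle

section Lie

/-- A Lie groupoid `Γ ⇉ M`: the spaces `M` and `Γ` are smooth manifolds (of dimensions `m`, `g`),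
source and target are surjective submersions (surjectivity is automatic because of the units) and
the structure maps are smooth. The multiplication is smooth on the embedded submanifold
`{(a, b) | s a = t b}` of `Γ × Γ`, i.e. it sends pairs of smooth maps `ℝⁿ → Γ` with values in this
submanifold to smooth maps. -/
structure LieGroupoid (m g : ℕ) (M : Type u) (Γ : Type v)
    [TopologicalSpace M] [ChartedSpace (EuclideanSpace ℝ (Fin m)) M]
    [TopologicalSpace Γ] [ChartedSpace (EuclideanSpace ℝ (Fin g)) Γ]
    extends GroupoidStr M Γ where
  submersion_s : Manifold.IsSubmersion (𝓡 g) (𝓡 m) ∞ s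
  submersion_t : Manifold.IsSubmersion (𝓡 g) (𝓡 m) ∞ t
  smooth_one : ContMDiff (𝓡 m) (𝓡 g) ∞ one
  smooth_inv : ContMDiff (𝓡 g) (𝓡 g) ∞ inv
  smooth_mul : ∀ (n : ℕ) (P Q : EuclideanSpace ℝ (Fin n) → Γ) (h : ∀ x, s (P x) = t (Q x)),
    ContMDiff (𝓡 n) (𝓡 g) ∞ P → ContMDiff (𝓡 n) (𝓡 g) ∞ Q →
      ContMDiff (𝓡 n) (𝓡 g) ∞ fun x => mul (P x) (Q x) (h x)

variable {m g k : ℕ} {M : Type u} {Γ : Type v} {Γt : Type w}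
  [TopologicalSpace M] [ChartedSpace (EuclideanSpace ℝ (Fin m)) M]
  [TopologicalSpace Γ] [ChartedSpace (EuclideanSpace ℝ (Fin g)) Γ]
  [TopologicalSpace Γt] [ChartedSpace (EuclideanSpace ℝ (Fin k)) Γt]

theorem LieGroupoid.isSmooth (G : LieGroupoid m g M Γ) :
    @GroupoidStr.IsSmooth M Γ (manifoldDiffeology m M) (manifoldDiffeology g Γ)
      G.toGroupoidStr := by
  let _ := manifoldDiffeology m M
  let _ := manifoldDiffeology g Γ
  exact ⟨fun _ _ hP => ContMDiff.comp G.submersion_s.contMDiff hP,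
    fun _ _ hP => ContMDiff.comp G.submersion_t.contMDiff hP,
    fun _ _ hP => ContMDiff.comp G.smooth_one hP,
    fun _ _ hP => ContMDiff.comp G.smooth_inv hP,
    fun n P Q h hP hQ => G.smooth_mul n P Q h hP hQ⟩

/-- A Lie groupoid `Γ ⇉ M`, regarded as the Lie 2-groupoid `Γ ⇉ Γ ⇉ M` with only identity
2-arrows. -/
@[reducible]
def LieGroupoid.toTwoGroupoid (G : LieGroupoid m g M Γ) : TwoGroupoid.{u, v, v} where
  Ob := M
  One := Γ
  Two := Γ
  diffOb := manifoldDiffeology m M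
  diffOne := manifoldDiffeology g Γ
  diffTwo := manifoldDiffeology g Γ
  hor := G.toGroupoidStr
  ver := GroupoidStr.discrete Γ
  hor₂ := G.toGroupoidStr
  smooth_hor := G.isSmooth
  smooth_ver := @GroupoidStr.discrete_isSmooth Γ (manifoldDiffeology g Γ)
  smooth_hor₂ := G.isSmooth
  s_l _ := rfl
  s_u _ := rfl
  t_l _ := rfl
  t_u _ := rfl
  l_hmul _ _ _ := rfl
  u_hmul _ _ _ := rfl
  l_hone _ := rfl
  u_hone _ := rfl
  vone_mul _ _ _ _ := rfl
  vone_one _ := rfl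
  interchange _ _ _ _ _ _ _ _ _ _ := rfl

/-- A central `S¹`-extension of Lie groupoids over the identity of `M`: a short exact sequence
`1 → M × S¹ → Γt → Γ → 1` of Lie groupoids, with maps `i` and `φ`, such that
`z · γ = γ · z` for all `γ ∈ Γt` and `z ∈ S¹`. -/
structure CentralExtension (Gt : LieGroupoid m k M Γt) (G : LieGroupoid m g M Γ) where
  φ : Γt → Γ
  i : M × Circle → Γt
  φ_submersion : Manifold.IsSubmersion (𝓡 k) (𝓡 g) ∞ φ
  φ_surjective : Function.Surjective φ
  φ_functor : Gt.toGroupoidStr.IsFunctor G.toGroupoidStr id φ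
  i_embedding : Manifold.IsSmoothEmbedding ((𝓡 m).prod (𝓡 1)) (𝓡 k) ∞ i
  i_functor : (GroupoidStr.groupBundle M Circle).IsFunctor Gt.toGroupoidStr id i
  exactness : ∀ γ, (∃ x, φ γ = G.one x) ↔ γ ∈ Set.range i
  central : ∀ γ z (h : Gt.s (i (Gt.t γ, z)) = Gt.t γ) (h' : Gt.s γ = Gt.t (i (Gt.s γ, z))),
    Gt.mul (i (Gt.t γ, z)) γ h = Gt.mul γ (i (Gt.s γ, z)) h'

namespace CentralExtension

variable {Gt : LieGroupoid m k M Γt} {G : LieGroupoid m g M Γ} (ext : CentralExtension Gt G)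

theorem s_i (x : M) (z : Circle) : Gt.s (ext.i (x, z)) = x := ext.i_functor.map_s (x, z)

theorem t_i (x : M) (z : Circle) : Gt.t (ext.i (x, z)) = x := ext.i_functor.map_t (x, z)

/-- The right action of `S¹` on `Γt`. -/
def act (z : Circle) (γ : Γt) : Γt := Gt.mul γ (ext.i (Gt.s γ, z)) (ext.t_i _ _).symm


/-- The fibre product `Γt ×_Γ Γt`. -/
abbrev FibreProduct : Type w := {a : Γt × Γt // ext.φ a.1 = ext.φ a.2}

/-- The first projection of the fibre product. -/
def pr₁ (a : ext.FibreProduct) : Γt := a.1.1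

/-- The second projection of the fibre product. -/
def pr₂ (a : ext.FibreProduct) : Γt := a.1.2

/-- The subspace diffeology of `Γt ×_Γ Γt ⊆ Γt × Γt`. -/
@[reducible]
def fibreDiffeology : DiffeologicalSpace ext.FibreProduct where
  plots n := {P | ContMDiff (𝓡 n) (𝓡 k) ∞ (ext.pr₁ ∘ P) ∧ ContMDiff (𝓡 n) (𝓡 k) ∞ (ext.pr₂ ∘ P)}
  constant_plots _ := ⟨contMDiff_const, contMDiff_const⟩
  plot_reparam {_ m p f} hp hf :=
    ⟨ContMDiff.comp (I' := 𝓡 m) (g := ext.pr₁ ∘ p) (f := f) hp.1 hf.contMDiff,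
      ContMDiff.comp (I' := 𝓡 m) (g := ext.pr₂ ∘ p) (f := f) hp.2 hf.contMDiff⟩
  locality := by
    intro n P hP
    constructor
    all_goals
      refine (manifoldDiffeology k Γt).locality fun x => ?_
      obtain ⟨U, hU, hx, H⟩ := hP x
      refine ⟨U, hU, hx, fun hf hf' => ?_⟩
    · exact (H hf hf').1
    · exact (H hf hf').2

theorem isPlot_iff {n : ℕ} {P : EuclideanSpace ℝ (Fin n) → ext.FibreProduct} :
    @IsPlot _ ext.fibreDiffeology n P ↔
      ContMDiff (𝓡 n) (𝓡 k) ∞ (ext.pr₁ ∘ P) ∧ ContMDiff (𝓡 n) (𝓡 k) ∞ (ext.pr₂ ∘ P) := Iff.rfl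

theorem dSmooth_pr₁ : @DSmooth _ _ ext.fibreDiffeology (manifoldDiffeology k Γt) ext.pr₁ :=
  fun _ _ hP => (ext.isPlot_iff.1 hP).1

theorem dSmooth_pr₂ : @DSmooth _ _ ext.fibreDiffeology (manifoldDiffeology k Γt) ext.pr₂ :=
  fun _ _ hP => (ext.isPlot_iff.1 hP).2

/-- The vertical groupoid `Γt ×_Γ Γt ⇉ Γt`: `l (a, b) = b`, `u (a, b) = a`,
`(a, b) ⋆ (b, c) = (a, c)`. -/
def verGroupoid : GroupoidStr Γt ext.FibreProduct where
  s a := a.1.2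
  t a := a.1.1
  mul a b h := ⟨(a.1.1, b.1.2), a.2.trans ((congrArg ext.φ h).trans b.2)⟩
  one a := ⟨(a, a), rfl⟩
  inv a := ⟨(a.1.2, a.1.1), a.2.symm⟩
  s_mul _ _ _ := rfl
  t_mul _ _ _ := rfl
  s_one _ := rfl
  t_one _ := rfl
  s_inv _ := rfl
  t_inv _ := rfl
  mul_assoc _ _ _ _ _ := rfl
  one_mul _ := rfl
  mul_one _ := rfl
  inv_mul _ := rfl
  mul_inv _ := rfl

theorem s_eq (a : ext.FibreProduct) : Gt.s a.1.1 = Gt.s a.1.2 :=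
  (ext.φ_functor.map_s a.1.1).symm.trans
    ((congrArg G.s a.2).trans (ext.φ_functor.map_s a.1.2))

theorem t_eq (a : ext.FibreProduct) : Gt.t a.1.1 = Gt.t a.1.2 :=
  (ext.φ_functor.map_t a.1.1).symm.trans
    ((congrArg G.t a.2).trans (ext.φ_functor.map_t a.1.2))

theorem φ_composable {a b : Γt} (h : Gt.s a = Gt.t b) : G.s (ext.φ a) = G.t (ext.φ b) :=
  (ext.φ_functor.map_s a).trans (h.trans (ext.φ_functor.map_t b).symm)

theorem mul_congr (G : LieGroupoid m g M Γ) {a b a' b' : Γ} (ha : a = a') (hb : b = b')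
    (h : G.s a = G.t b) (h' : G.s a' = G.t b') : G.mul a b h = G.mul a' b' h' := by
  subst ha hb
  rfl

theorem φ_mul_congr {a b a' b' : Γt} (h : Gt.s a = Gt.t b) (h' : Gt.s a' = Gt.t b')
    (ha : ext.φ a = ext.φ a') (hb : ext.φ b = ext.φ b') :
    ext.φ (Gt.mul a b h) = ext.φ (Gt.mul a' b' h') := by
  rw [ext.φ_functor.map_mul a b h (ext.φ_composable h),
    ext.φ_functor.map_mul a' b' h' (ext.φ_composable h')]
  simp only [ha, hb]

/-- The horizontal groupoid `Γt ×_Γ Γt ⇉ M`, with the componentwise product. -/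
def horGroupoid : GroupoidStr M ext.FibreProduct where
  s a := Gt.s a.1.1
  t a := Gt.t a.1.1
  mul a b h := ⟨(Gt.mul a.1.1 b.1.1 h,
      Gt.mul a.1.2 b.1.2 ((ext.s_eq a).symm.trans (h.trans (ext.t_eq b)))),
    ext.φ_mul_congr _ _ a.2 b.2⟩
  one x := ⟨(Gt.one x, Gt.one x), rfl⟩
  inv a := ⟨(Gt.inv a.1.1, Gt.inv a.1.2), by
    rw [ext.φ_functor.map_inv, ext.φ_functor.map_inv, a.2]⟩
  s_mul a b h := Gt.s_mul _ _ _
  t_mul a b h := Gt.t_mul _ _ _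
  s_one x := Gt.s_one x
  t_one x := Gt.t_one x
  s_inv a := Gt.s_inv _
  t_inv a := Gt.t_inv _
  mul_assoc a b c hab hbc := Subtype.ext (Prod.ext (Gt.mul_assoc _ _ _ _ _)
    (Gt.mul_assoc _ _ _ _ _))
  one_mul a := Subtype.ext (Prod.ext (Gt.one_mul _) (by simp only [ext.t_eq a, Gt.one_mul]))
  mul_one a := Subtype.ext (Prod.ext (Gt.mul_one _) (by simp only [ext.s_eq a, Gt.mul_one]))
  inv_mul a := Subtype.ext (Prod.ext (Gt.inv_mul _) (by simp only [ext.s_eq a, Gt.inv_mul]))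
  mul_inv a := Subtype.ext (Prod.ext (Gt.mul_inv _) (by simp only [ext.t_eq a, Gt.mul_inv]))

theorem verGroupoid_isSmooth :
    @GroupoidStr.IsSmooth Γt ext.FibreProduct (manifoldDiffeology k Γt) ext.fibreDiffeology
      ext.verGroupoid := by
  let _ := manifoldDiffeology k Γt
  let _ := ext.fibreDiffeology
  refine ⟨ext.dSmooth_pr₂, ext.dSmooth_pr₁, fun _ _ hP => ext.isPlot_iff.2 ⟨hP, hP⟩,
    fun _ _ hP => ext.isPlot_iff.2 (ext.isPlot_iff.1 hP).symm, fun _ _ _ _ hP hQ => ?_⟩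
  exact ext.isPlot_iff.2 ⟨(ext.isPlot_iff.1 hP).1, (ext.isPlot_iff.1 hQ).2⟩

theorem horGroupoid_isSmooth :
    @GroupoidStr.IsSmooth M ext.FibreProduct (manifoldDiffeology m M) ext.fibreDiffeology
      ext.horGroupoid := by
  let _ := manifoldDiffeology m M
  let _ := ext.fibreDiffeology
  let _ := manifoldDiffeology k Γt
  have hG := Gt.isSmooth
  refine ⟨hG.smooth_s.comp ext.dSmooth_pr₁, hG.smooth_t.comp ext.dSmooth_pr₁,
    fun n P hP => ext.isPlot_iff.2 ⟨hG.smooth_one n P hP, hG.smooth_one n P hP⟩,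
    fun n P hP => ext.isPlot_iff.2 ⟨hG.smooth_inv n _ (ext.isPlot_iff.1 hP).1,
      hG.smooth_inv n _ (ext.isPlot_iff.1 hP).2⟩, fun n P Q h hP hQ => ?_⟩
  exact ext.isPlot_iff.2
    ⟨Gt.smooth_mul n _ _ _ (ext.isPlot_iff.1 hP).1 (ext.isPlot_iff.1 hQ).1,
      Gt.smooth_mul n _ _ (fun x => (ext.s_eq (P x)).symm.trans ((h x).trans (ext.t_eq (Q x))))
        (ext.isPlot_iff.1 hP).2 (ext.isPlot_iff.1 hQ).2⟩

/-- The 2-groupoid `Γt ×_Γ Γt ⇉ Γt ⇉ M` of a central extension. -/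
@[reducible]
def twoGroupoid : TwoGroupoid.{u, w, w} where
  Ob := M
  One := Γt
  Two := ext.FibreProduct
  diffOb := manifoldDiffeology m M
  diffOne := manifoldDiffeology k Γt
  diffTwo := ext.fibreDiffeology
  hor := Gt.toGroupoidStr
  ver := ext.verGroupoid
  hor₂ := ext.horGroupoid
  smooth_hor := Gt.isSmooth
  smooth_ver := ext.verGroupoid_isSmooth
  smooth_hor₂ := ext.horGroupoid_isSmooth
  s_l a := (ext.s_eq a).symm
  s_u _ := rfl
  t_l a := (ext.t_eq a).symm
  t_u _ := rfl
  l_hmul _ _ _ := rfl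
  u_hmul _ _ _ := rfl
  l_hone _ := rfl
  u_hone _ := rfl
  vone_mul _ _ _ _ := rfl
  vone_one _ := rfl
  interchange _ _ _ _ _ _ _ _ _ _ := rfl

/-- The morphism `φ` from `Γt ⇉ Γt ⇉ M` to `Γ ⇉ Γ ⇉ M`. -/
def φGroupoidHom : Gt.toTwoGroupoid.Hom G.toTwoGroupoid where
  f₀ := id
  f₁ := ext.φ
  f₂ := ext.φ
  smooth₀ _ _ hP := hP
  smooth₁ _ _ hP := ContMDiff.comp ext.φ_submersion.contMDiff hP
  smooth₂ _ _ hP := ContMDiff.comp ext.φ_submersion.contMDiff hP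
  hor := ext.φ_functor
  ver := ⟨fun _ => rfl, fun _ => rfl, fun _ => rfl, fun _ => rfl, fun _ _ _ _ => rfl⟩
  hor₂ := ext.φ_functor

/-- The morphism `φ` from `Γt ×_Γ Γt ⇉ Γt ⇉ M` to `Γ ⇉ Γ ⇉ M` induced by the extension. -/
def φHom : ext.twoGroupoid.Hom G.toTwoGroupoid where
  f₀ := id
  f₁ := ext.φ
  f₂ a := ext.φ a.1.1
  smooth₀ _ _ hP := hP
  smooth₁ _ _ hP := ContMDiff.comp ext.φ_submersion.contMDiff hP
  smooth₂ _ P hP := ContMDiff.comp (I' := 𝓡 k) (g := ext.φ) (f := ext.pr₁ ∘ P)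
    ext.φ_submersion.contMDiff (ext.dSmooth_pr₁ _ _ hP)
  hor := ext.φ_functor
  ver := ⟨fun a => a.2, fun _ => rfl, fun _ => rfl, fun a => a.2.symm, fun _ _ _ _ => rfl⟩
  hor₂ := ⟨fun a => ext.φ_functor.map_s a.1.1, fun a => ext.φ_functor.map_t a.1.1,
    fun x => ext.φ_functor.map_one x, fun a => ext.φ_functor.map_inv a.1.1,
    fun a b h h' => ext.φ_functor.map_mul a.1.1 b.1.1 h h'⟩

/-! #### The morphism to the 2-group `[S¹ → 1]` -/

/-- The quotient `γ₁ γ₂⁻¹` of a pair `(γ₁, γ₂)` in the fibre product. -/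
def quot (a : ext.FibreProduct) : Γt :=
  Gt.mul a.1.1 (Gt.inv a.1.2) ((ext.s_eq a).trans (Gt.t_inv _).symm)

theorem exists_quot (a : ext.FibreProduct) : ∃ z : Circle, ext.i (Gt.t a.1.1, z) = ext.quot a := by
  have h : ext.φ (ext.quot a) = G.one (Gt.t a.1.1) := by
    have h1 : ext.φ (ext.quot a) = ext.φ (Gt.mul a.1.1 (Gt.inv a.1.1) (Gt.t_inv _).symm) :=
      ext.φ_mul_congr _ _ rfl (by rw [ext.φ_functor.map_inv, ext.φ_functor.map_inv, a.2])
    rw [h1, Gt.mul_inv, ext.φ_functor.map_one]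
    rfl
  obtain ⟨⟨x, z⟩, hx⟩ := (ext.exactness _).1 ⟨_, h⟩
  have ht : x = Gt.t a.1.1 := by
    rw [← ext.t_i x z, hx]
    exact Gt.t_mul _ _ _
  exact ⟨z, by rw [← ht, hx]⟩

/-- The element `g ∈ S¹` with `γ₁ γ₂⁻¹ = g`, for `(γ₁, γ₂) ∈ Γt ×_Γ Γt`. -/
noncomputable def diff (a : ext.FibreProduct) : Circle := (ext.exists_quot a).choose

theorem diff_spec (a : ext.FibreProduct) :
    Gt.mul (ext.i (Gt.t a.1.2, ext.diff a)) a.1.2 (ext.s_i _ _) = a.1.1 := by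
  have h : ext.i (Gt.t a.1.1, ext.diff a) = ext.quot a := (ext.exists_quot a).choose_spec
  have e := ext.t_eq a
  have h2 : ext.i (Gt.t a.1.2, ext.diff a) = ext.quot a := by rw [← e]; exact h
  have hq : Gt.s (ext.quot a) = Gt.t a.1.2 := by rw [← h2, ext.s_i]
  rw [mul_congr Gt h2 rfl _ hq]
  unfold quot
  rw [Gt.mul_assoc _ _ _ _ (Gt.s_inv _)]
  refine (mul_congr Gt rfl ?_ _ ?_).trans (Gt.mul_one a.1.1)
  · rw [Gt.inv_mul, ext.s_eq a]
  · rw [Gt.t_one]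

theorem mul_right_cancel' {a b c : Γt} (h : Gt.s a = Gt.t c) (h' : Gt.s b = Gt.t c)
    (e : Gt.mul a c h = Gt.mul b c h') : a = b := by
  have key : ∀ (x : Γt) (hx : Gt.s x = Gt.t c), Gt.mul (Gt.mul x c hx) (Gt.inv c)
      ((Gt.s_mul _ _ _).trans (Gt.t_inv c).symm) = x := by
    intro x hx
    rw [Gt.mul_assoc x c (Gt.inv c) hx (Gt.t_inv c).symm]
    simp only [Gt.mul_inv, ← hx, Gt.mul_one]
  rw [← key a h, ← key b h']
  simp only [e]

/-- `diff a` is the only element of `S¹` with `g · γ₂ = γ₁`. -/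
theorem diff_unique (a : ext.FibreProduct) (z : Circle)
    (h : Gt.mul (ext.i (Gt.t a.1.2, z)) a.1.2 (ext.s_i _ _) = a.1.1) : z = ext.diff a := by
  have h1 := mul_right_cancel' _ _ (h.trans (ext.diff_spec a).symm)
  exact congrArg Prod.snd (ext.i_embedding.isEmbedding.injective h1)

theorem i_mul (x : M) (z z' : Circle) : Gt.mul (ext.i (x, z)) (ext.i (x, z'))
    ((ext.s_i x z).trans (ext.t_i x z').symm) = ext.i (x, z * z') :=
  (ext.i_functor.map_mul (x, z) (x, z') rfl _).symm

theorem diff_smooth :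
    @DSmooth ext.FibreProduct Circle ext.fibreDiffeology (manifoldDiffeology 1 Circle)
      ext.diff := by
  intro n P hP
  let _ := ext.fibreDiffeology
  change ContMDiff (𝓡 n) (𝓡 1) ∞ (ext.diff ∘ P)
  have h1 : ContMDiff (𝓡 n) (𝓡 k) ∞ fun x => ext.quot (P x) :=
    Gt.smooth_mul n _ _ _ (ext.dSmooth_pr₁ n P hP)
      (ContMDiff.comp Gt.smooth_inv (ext.dSmooth_pr₂ n P hP))
  have h2 : (ext.i ∘ fun x => (Gt.t (P x).1.1, ext.diff (P x))) = fun x => ext.quot (P x) :=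
    funext fun x => (ext.exists_quot (P x)).choose_spec
  have h3 : ContMDiff (𝓡 n) ((𝓡 m).prod (𝓡 1)) ∞
      fun x => (Gt.t (P x).1.1, ext.diff (P x)) := by
    rw [ContMDiff.iff_comp_isImmersion ext.i_embedding.isImmersion, h2]
    refine ⟨?_, h1⟩
    rw [ext.i_embedding.isEmbedding.continuous_iff, h2]
    exact h1.continuous
  exact h3.snd

/-- The morphism `f` from `Γt ×_Γ Γt ⇉ Γt ⇉ M` to `S¹ ⇉ * ⇉ *`, which sends the 2-arrow
`(γ₁, γ₂)` to `γ₁ γ₂⁻¹ ∈ S¹`. -/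
noncomputable def fHom : ext.twoGroupoid.Hom circleTwoGroup where
  f₀ _ := ()
  f₁ _ := ()
  f₂ := ext.diff
  smooth₀ _ _ _ := trivial
  smooth₁ _ _ _ := trivial
  smooth₂ := ext.diff_smooth
  hor := ⟨fun _ => rfl, fun _ => rfl, fun _ => rfl, fun _ => rfl, fun _ _ _ _ => rfl⟩
  ver := by
    have hone : ∀ x, ext.diff (ext.verGroupoid.one x) = 1 := by
      intro x
      refine (ext.diff_unique _ 1 ?_).symm
      change Gt.mul (ext.i (Gt.t x, 1)) x _ = x
      have h := ext.i_functor.map_one (Gt.t x)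
      have h' : ext.i (Gt.t x, 1) = Gt.one (Gt.t x) := h
      simp only [h', Gt.one_mul]
    have hmul : ∀ a b (h : ext.verGroupoid.s a = ext.verGroupoid.t b),
        ext.diff (ext.verGroupoid.mul a b h) = ext.diff a * ext.diff b := by
      intro a b h
      refine (ext.diff_unique _ _ ?_).symm
      change Gt.mul (ext.i (Gt.t b.1.2, ext.diff a * ext.diff b)) b.1.2 _ = a.1.1
      have hab : a.1.2 = b.1.1 := h
      have ha := ext.diff_spec a
      have hb := ext.diff_spec b
      have ht : Gt.t a.1.2 = Gt.t b.1.2 := by rw [hab, ext.t_eq b]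
      refine (mul_congr Gt (ext.i_mul _ _ _).symm rfl _
        ((Gt.s_mul _ _ _).trans (ext.s_i _ _))).trans ?_
      refine (Gt.mul_assoc _ _ _ _ (ext.s_i _ _)).trans ?_
      refine (mul_congr Gt (by rw [ht]) (hb.trans hab.symm) _
        (ext.s_i (Gt.t a.1.2) (ext.diff a))).trans ?_
      exact ha
    refine ⟨fun _ => rfl, fun _ => rfl, hone, fun a => ?_, fun a b h _ => hmul a b h⟩
    change _ = (ext.diff a)⁻¹
    refine eq_inv_of_mul_eq_one_left ?_
    rw [← hmul (ext.verGroupoid.inv a) a (ext.verGroupoid.s_inv a), ext.verGroupoid.inv_mul, hone]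
  hor₂ := by
    have hone : ∀ x, ext.diff (ext.horGroupoid.one x) = 1 := by
      intro x
      refine (ext.diff_unique _ 1 ?_).symm
      change Gt.mul (ext.i (Gt.t (Gt.one x), 1)) (Gt.one x) _ = Gt.one x
      have h' : ext.i (Gt.t (Gt.one x), 1) = Gt.one (Gt.t (Gt.one x)) :=
        ext.i_functor.map_one _
      simp only [h', Gt.one_mul]
    have hmul : ∀ a b (h : ext.horGroupoid.s a = ext.horGroupoid.t b),
        ext.diff (ext.horGroupoid.mul a b h) = ext.diff a * ext.diff b := by
      intro a b h
      refine (ext.diff_unique _ _ ?_).symm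
      have hs : Gt.s a.1.2 = Gt.t b.1.2 :=
        (ext.s_eq a).symm.trans (Eq.trans h (ext.t_eq b))
      change Gt.mul (ext.i (Gt.t (Gt.mul a.1.2 b.1.2 hs), ext.diff a * ext.diff b))
        (Gt.mul a.1.2 b.1.2 hs) _ = Gt.mul a.1.1 b.1.1 h
      have ha := ext.diff_spec a
      have hb := ext.diff_spec b
      have ht : Gt.t (Gt.mul a.1.2 b.1.2 hs) = Gt.t a.1.2 := Gt.t_mul _ _ _
      have c := ext.central a.1.2 (ext.diff b) (ext.s_i _ _) (ext.t_i _ _).symm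
      have e0 : ext.i (Gt.t (Gt.mul a.1.2 b.1.2 hs), ext.diff a * ext.diff b) =
          Gt.mul (ext.i (Gt.t a.1.2, ext.diff a)) (ext.i (Gt.t a.1.2, ext.diff b))
            ((ext.s_i _ _).trans (ext.t_i _ _).symm) := by rw [ht, ext.i_mul]
      have e1 : Gt.mul (ext.i (Gt.t a.1.2, ext.diff b)) (Gt.mul a.1.2 b.1.2 hs)
          ((ext.s_i _ _).trans ht.symm) = Gt.mul a.1.2 b.1.1 (hs.trans (ext.t_eq b).symm) := by
        rw [← Gt.mul_assoc _ _ _ (ext.s_i _ _) hs,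
          mul_congr Gt c rfl _ ((Gt.s_mul _ _ _).trans ((ext.s_i _ _).trans hs)),
          Gt.mul_assoc _ _ _ (ext.t_i _ _).symm ((ext.s_i _ _).trans hs)]
        refine mul_congr Gt rfl (Eq.trans ?_ hb) _ _
        exact mul_congr Gt (by rw [hs]) rfl _ _
      refine (mul_congr Gt e0 rfl _
        ((Gt.s_mul _ _ _).trans ((ext.s_i _ _).trans ht.symm))).trans ?_
      refine (Gt.mul_assoc _ _ _ _ ((ext.s_i _ _).trans ht.symm)).trans ?_
      refine (mul_congr Gt rfl e1 _ ((ext.s_i _ _).trans (Gt.t_mul _ _ _).symm)).trans ?_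
      refine (Gt.mul_assoc _ _ _ (ext.s_i _ _) (hs.trans (ext.t_eq b).symm)).symm.trans ?_
      exact mul_congr Gt ha rfl _ _
    refine ⟨fun _ => rfl, fun _ => rfl, hone, fun a => ?_, fun a b h _ => hmul a b h⟩
    change _ = (ext.diff a)⁻¹
    refine eq_inv_of_mul_eq_one_left ?_
    rw [← hmul (ext.horGroupoid.inv a) a (ext.horGroupoid.s_inv a), ext.horGroupoid.inv_mul, hone]


/-! #### Connections and the cocycle `Ω_θ` -/

theorem dSmooth_act (z : Circle) :
    @DSmooth Γt Γt (manifoldDiffeology k Γt) (manifoldDiffeology k Γt) (ext.act z) :=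
  fun n P hP => Gt.smooth_mul n P (fun x => ext.i (Gt.s (P x), z)) (fun _ => (ext.t_i _ _).symm) hP
    (ext.i_embedding.contMDiff.comp
      ((ContMDiff.comp Gt.submersion_s.contMDiff hP).prodMk contMDiff_const))

/-- The smooth curve `τ ↦ γ · e^(iτ)` in `Γt`. -/
noncomputable def orbit (γ : Γt) : @Plot Γt (manifoldDiffeology k Γt) 1 :=
  ⟨fun x => ext.act (Circle.exp (x 0)) γ,
    Gt.smooth_mul 1 (fun _ => γ) (fun x => ext.i (Gt.s γ, Circle.exp (x 0)))
      (fun _ => (ext.t_i _ _).symm) contMDiff_const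
      (ext.i_embedding.contMDiff.comp (contMDiff_const.prodMk
        (contMDiff_circleExp.comp (EuclideanSpace.proj (𝕜 := ℝ) (0 : Fin 1)).contDiff.contMDiff)))⟩

/-- The 1-form `θ` on `Γt` is a connection form of the principal `S¹`-bundle `φ : Γt → Γ`: it is
`S¹`-invariant and takes the value `1` on the velocity at `τ = 0` of each curve `γ · e^(iτ)`. -/
structure IsConnection (θ : ManifoldForm k Γt 1) : Prop where
  invariant : ∀ z : Circle, @Form.pullback Γt Γt (manifoldDiffeology k Γt)
    (manifoldDiffeology k Γt) (ext.act z) (ext.dSmooth_act z) 1 θ = θ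
  normalized : ∀ γ : Γt, @Form.on Γt (manifoldDiffeology k Γt) 1 1 θ (ext.orbit γ) 0
    (fun _ => EuclideanSpace.single 0 1) = 1

/-- `Ω` is the cocycle `Ω_θ ∈ Z³(Γ ⇉ Γ ⇉ M)` induced by `θ`, i.e. `φ^* Ω = dθ + ∂θ` in the total
complex of `Γt ⇉ Γt ⇉ M`, where `θ ∈ Ω¹(Γt)` has total degree `2`. -/
def IsInducedCocycle (θ : ManifoldForm k Γt 1) (Om : G.toTwoGroupoid.cocycles 3) : Prop :=
  ext.φGroupoidHom.pullback 3 (Om : G.toTwoGroupoid.TotalForm 3) =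
    Gt.toTwoGroupoid.totalD 2 (Gt.toTwoGroupoid.ofOneArrows θ)

end CentralExtension

end Lie

end TwoGpd

/-!
A connection form `θ` changes in a simple way along the fibres of `φ : Γt → Γ`: if two smooth maps
`P, Q : ℝⁿ → Γt` have the same image in `Γ`, then `P = Q · z` for a smooth map `z : ℝⁿ → S¹`, and
`θ(P) = θ(Q) + z^* dt`. In other words `pr₁^* θ - pr₂^* θ = f^* dt` on `Γt ×_Γ Γt`
(`IsConnection.pullback_pr₁`). Everything else follows from this identity.

*Existence and uniqueness of `Ω_θ`.* Since `φ` is a surjective submersion, plots of the nerve of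
`Γ ⇉ Γ ⇉ M` lift locally to the nerve of `Γt ⇉ Γt ⇉ M` (`hasLocalLifts_nerve`). Hence `φ^*` is
injective on cochains, which gives uniqueness, and a form upstairs is a pullback as soon as it takes
the same value on any two plots with the same image (`Form.exists_pullback_eq`). The latter holds for
`dθ`, because `dt` is closed, and for `∂θ`, because the functions `z₀₁`, `z₁₂`, `z₀₂` attached to the
edges of a triangle satisfy `z₀₂ = z₁₂ z₀₁` and `dt` is additive. The resulting cochain is a cocycle
because its pullback `(d + ∂)² θ` vanishes.

*Comparison of the classes.* The form `θ` is also a 2-cochain of `Γt ×_Γ Γt ⇉ Γt ⇉ M`. A triangle of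
that nerve with edges `g₀₁`, `g₁₂`, `g₀₂` maps to the same triangle of `Γ ⇉ Γ ⇉ M` as the triangle of
`Γt ⇉ Γt ⇉ M` with edges `g₀₁`, `g₁₂`, `g₁₂ g₀₁`. So `φ^* Ω_θ` and `(d + ∂) θ` differ by
`θ(g₁₂ g₀₁) - θ(g₀₂)`, which is the pullback of `dt` under `(g₁₂ g₀₁) g₀₂⁻¹`, i.e. `f^* dt`
(`IsConnection.totalD_ofOneArrows`).
-/

open scoped Topology

namespace TwoGpd

universe u v w

/-! ### Locality and descent of forms -/

/-- A neighbourhood of a point of `ℝⁿ` contains the image of a smooth map `ℝⁿ → ℝⁿ` that is the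
identity near the point. -/
theorem exists_contDiff_eventuallyEq_id {n : ℕ} {x : EuclideanSpace ℝ (Fin n)}
    {U : Set (EuclideanSpace ℝ (Fin n))} (hU : U ∈ 𝓝 x) :
    ∃ F : EuclideanSpace ℝ (Fin n) → EuclideanSpace ℝ (Fin n),
      ContDiff ℝ ∞ F ∧ (∀ y, F y ∈ U) ∧ F =ᶠ[𝓝 x] id := by
  obtain ⟨r, hr, hrU⟩ := Metric.mem_nhds_iff.1 hU
  let b : ContDiffBump x := ⟨r / 2, r, by positivity, by linarith⟩
  refine ⟨fun y => x + b y • (y - x), ?_, fun y => hrU ?_, ?_⟩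
  · exact contDiff_const.add (b.contDiff.smul (contDiff_id.sub contDiff_const))
  · by_cases hy : y ∈ Metric.ball x r
    · rw [Metric.mem_ball, dist_eq_norm] at hy ⊢
      rw [add_sub_cancel_left, norm_smul, Real.norm_of_nonneg b.nonneg]
      exact (mul_le_of_le_one_left (norm_nonneg _) b.le_one).trans_lt hy
    · have h0 : b y = 0 := b.zero_of_le_dist (not_lt.1 hy)
      simpa [h0] using hr
  · filter_upwards [b.eventuallyEq_one] with y hy
    simp only [Pi.one_apply] at hy
    simp [hy]

section Descent

variable {X : Type u} {Y : Type v} [DiffeologicalSpace X] [DiffeologicalSpace Y] {p : ℕ}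

theorem Form.on_reparam (α : Form X p) {m n : ℕ} (P : Plot X n)
    {F : EuclideanSpace ℝ (Fin m) → EuclideanSpace ℝ (Fin n)} (hF : ContDiff ℝ ∞ F)
    (x : EuclideanSpace ℝ (Fin m)) :
    α.on (P.reparam F hF) x = (α.on P (F x)).compContinuousLinearMap (fderiv ℝ F x) :=
  α.2.2 m n P F hF x

theorem Form.on_reparam_of_eventuallyEq_id (α : Form X p) {n : ℕ} (P : Plot X n)
    {F : EuclideanSpace ℝ (Fin n) → EuclideanSpace ℝ (Fin n)} (hF : ContDiff ℝ ∞ F)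
    {x : EuclideanSpace ℝ (Fin n)} (h : F =ᶠ[𝓝 x] id) :
    α.on (P.reparam F hF) x = α.on P x := by
  rw [α.on_reparam, h.fderiv_eq, h.self_of_nhds, fderiv_id]
  rfl

/-- The value of a form on a plot at a point depends only on the germ of the plot. -/
theorem Form.on_congr (α : Form X p) {n : ℕ} {P Q : Plot X n} {x : EuclideanSpace ℝ (Fin n)}
    (h : P.1 =ᶠ[𝓝 x] Q.1) : α.on P x = α.on Q x := by
  obtain ⟨F, hF, hFU, hFx⟩ := exists_contDiff_eventuallyEq_id h
  have hPQ : P.reparam F hF = Q.reparam F hF := Subtype.ext (funext fun y => hFU y)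
  rw [← α.on_reparam_of_eventuallyEq_id P hF hFx, hPQ, α.on_reparam_of_eventuallyEq_id Q hF hFx]

theorem Form.pullback_pullback_of_eq {Z : Type w} [DiffeologicalSpace Z] {f : X → Y} {g : Y → Z}
    {k : X → Z} (hf : DSmooth f) (hg : DSmooth g) (hk : DSmooth k) (h : ∀ x, g (f x) = k x)
    (α : Form Z p) : Form.pullback f hf p (Form.pullback g hg p α) = Form.pullback k hk p α := by
  obtain rfl : g ∘ f = k := funext h
  rfl

/-- Every plot of `X` lifts locally through `π : Y → X`. For a smooth map `π` this says that `π` is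
a subduction. The local lifts are the germs of plots defined on all of `ℝⁿ`. -/
def HasLocalLifts (π : Y → X) : Prop :=
  ∀ (n : ℕ) (P : Plot X n) (x : EuclideanSpace ℝ (Fin n)),
    ∃ Q : Plot Y n, π ∘ Q.1 =ᶠ[𝓝 x] P.1

theorem Form.pullback_injective {π : Y → X} (hπ : DSmooth π) (h : HasLocalLifts π) :
    Function.Injective (Form.pullback π hπ p) := by
  intro α β hαβ
  ext1 n P x
  obtain ⟨Q, hQ⟩ := h n P x
  have hα : α.on P x = α.on (Q.push π hπ) x := α.on_congr hQ.symm
  have hβ : β.on P x = β.on (Q.push π hπ) x := β.on_congr hQ.symm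
  rw [hα, hβ]
  exact congrArg (fun η : Form Y p => η.on Q x) hαβ

/-- Descent along a subduction: a form on `Y` that takes the same value on any two plots with the
same image in `X` is the pullback of a form on `X`. -/
theorem Form.exists_pullback_eq {π : Y → X} (hπ : DSmooth π) (h : HasLocalLifts π) (β : Form Y p)
    (hβ : ∀ (n : ℕ) (Q Q' : Plot Y n), π ∘ Q.1 = π ∘ Q'.1 → β.on Q = β.on Q') :
    ∃ η : Form X p, Form.pullback π hπ p η = β := by
  have hloc : ∀ (n : ℕ) (Q Q' : Plot Y n) (x : EuclideanSpace ℝ (Fin n)),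
      π ∘ Q.1 =ᶠ[𝓝 x] π ∘ Q'.1 → β.on Q x = β.on Q' x := by
    intro n Q Q' x hQ
    obtain ⟨F, hF, hFU, hFx⟩ := exists_contDiff_eventuallyEq_id hQ
    rw [← β.on_reparam_of_eventuallyEq_id Q hF hFx, ← β.on_reparam_of_eventuallyEq_id Q' hF hFx,
      hβ n (Q.reparam F hF) (Q'.reparam F hF) (funext fun y => hFU y)]
  choose L hL using h
  have hnear : ∀ (n : ℕ) (P : Plot X n) (x : EuclideanSpace ℝ (Fin n)),
      (fun y => β.on (L n P y) y) =ᶠ[𝓝 x] β.on (L n P x) := by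
    intro n P x
    filter_upwards [(hL n P x).eventually_nhds] with y hy
    exact hloc n _ _ y ((hL n P y).trans (Filter.EventuallyEq.symm hy))
  refine ⟨⟨fun n P x => β.on (L n P x) x, fun n P => ?_, fun m n P F hF x => ?_⟩, ?_⟩
  · exact contDiff_iff_contDiffAt.2 fun x =>
      ((β.2.1 n (L n P x)).contDiffAt).congr_of_eventuallyEq (hnear n P x)
  · have e := hloc m (L m (P.reparam F hF) x) ((L n P (F x)).reparam F hF) x
      ((hL m (P.reparam F hF) x).trans
        ((hF.continuous.tendsto x).eventually (hL n P (F x)).symm))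
    change β.on (L m (P.reparam F hF) x) x = _
    rw [e, β.on_reparam]
  · ext1 n Q x
    exact hloc n _ _ x (hL n (Q.push π hπ) x)

theorem Form.d_d (α : Form X p) : Form.d (p + 1) (Form.d p α) = 0 := by
  ext1 n P x
  exact congrFun (extDeriv_extDeriv (r := ∞) (α.2.1 n P)
    (by simp only [minSmoothness_of_isRCLikeNormedField]; exact WithTop.coe_le_coe.2 le_top)) x

end Descent

/-! ### Lifting plots of the nerve -/

/-- Smooth maps `ℝⁿ → Γ` lift locally through a surjective submersion: compose with a section that
is constant in the fibre coordinate of a submersion chart. -/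
theorem exists_lift_of_isSubmersion {k g n : ℕ} {Y X : Type*} [TopologicalSpace Y]
    [ChartedSpace (EuclideanSpace ℝ (Fin k)) Y] [IsManifold (𝓡 k) ∞ Y]
    [TopologicalSpace X] [ChartedSpace (EuclideanSpace ℝ (Fin g)) X] [IsManifold (𝓡 g) ∞ X]
    {φ : Y → X} (hφ : Manifold.IsSubmersion (𝓡 k) (𝓡 g) ∞ φ) (hs : Function.Surjective φ)
    {P : EuclideanSpace ℝ (Fin n) → X} (hP : ContMDiff (𝓡 n) (𝓡 g) ∞ P)
    (x : EuclideanSpace ℝ (Fin n)) :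
    ∃ Q : EuclideanSpace ℝ (Fin n) → Y, ContMDiff (𝓡 n) (𝓡 k) ∞ Q ∧ φ ∘ Q =ᶠ[𝓝 x] P := by
  obtain ⟨γ, hγ⟩ := hs (P x)
  obtain ⟨E, _, _, h⟩ := hφ.isSubmersionAt γ
  let c := h.domChart
  let d := h.codChart
  let e := h.equiv
  let τ : EuclideanSpace ℝ (Fin g) → EuclideanSpace ℝ (Fin k) := fun y => e.symm (y, (e (c γ)).2)
  have hw : ∀ y ∈ c.target, d (φ (c.symm y)) = (e y).1 := by
    intro y hy
    have hy' : y ∈ (c.extend (𝓡 k)).target := by simpa using hy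
    simpa using h.writtenInCharts hy'
  have hcγ : c γ ∈ c.target := c.map_source h.mem_domChart_source
  have hτγ : τ (d (P x)) = c γ := by
    have h1 := hw _ hcγ
    rw [c.left_inv h.mem_domChart_source, hγ] at h1
    simp only [τ, h1, Prod.mk.eta, ContinuousLinearEquiv.symm_apply_apply]
  have hτ : ContDiff ℝ ∞ τ := e.symm.contDiff.comp (contDiff_id.prodMk contDiff_const)
  have hdx : P x ∈ d.source := hγ ▸ h.mem_codChart_source
  have hdP : ContMDiffOn (𝓡 n) (𝓡 k) ∞ (τ ∘ d ∘ P) (P ⁻¹' d.source) :=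
    hτ.contMDiff.comp_contMDiffOn ((contMDiffOn_of_mem_maximalAtlas
      h.codChart_mem_maximalAtlas).comp hP.contMDiffOn subset_rfl)
  have hU : P ⁻¹' d.source ∩ (τ ∘ d ∘ P) ⁻¹' c.target ∈ 𝓝 x := by
    have ho : IsOpen (P ⁻¹' d.source) := d.open_source.preimage hP.continuous
    refine (hdP.continuousOn.isOpen_inter_preimage ho c.open_target).mem_nhds ⟨hdx, ?_⟩
    change τ (d (P x)) ∈ c.target
    rwa [hτγ]
  obtain ⟨F, hF, hFU, hFx⟩ := exists_contDiff_eventuallyEq_id hU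
  refine ⟨fun y => c.symm (τ (d (P (F y)))), ?_, ?_⟩
  · have h1 : ContMDiff (𝓡 n) (𝓡 k) ∞ fun y => τ (d (P (F y))) := by
      rw [← contMDiffOn_univ]
      exact hdP.comp hF.contMDiff.contMDiffOn fun y _ => (hFU y).1
    rw [← contMDiffOn_univ] at h1 ⊢
    exact (contMDiffOn_symm_of_mem_maximalAtlas h.domChart_mem_maximalAtlas).comp h1
      fun y _ => (hFU y).2
  · filter_upwards [hFx] with y hy
    have hm : τ (d (P (F y))) ∈ c.target := (hFU y).2
    have h1 : d (φ (c.symm (τ (d (P (F y)))))) = d (P (F y)) := by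
      rw [hw _ hm]
      simp [τ]
    have h2 := d.injOn (h.source_subset_preimage_source (c.map_target hm)) (hFU y).1 h1
    change φ (c.symm (τ (d (P (F y))))) = P y
    rw [h2, hy, id]

section Lie

variable {m g k : ℕ} {M : Type u} {Γ : Type v} {Γt : Type w}
  [TopologicalSpace M] [ChartedSpace (EuclideanSpace ℝ (Fin m)) M]
  [TopologicalSpace Γ] [ChartedSpace (EuclideanSpace ℝ (Fin g)) Γ]
  [TopologicalSpace Γt] [ChartedSpace (EuclideanSpace ℝ (Fin k)) Γt]

namespace GroupoidStr

variable {Ob : Type u} {Arr : Type v} (G : GroupoidStr Ob Arr)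

theorem mul_congr' {a b a' b' : Arr} (ha : a = a') (hb : b = b')
    (h : G.s a = G.t b) (h' : G.s a' = G.t b') : G.mul a b h = G.mul a' b' h' := by
  subst ha hb
  rfl

/-- The quotient `a b⁻¹` of two arrows with the same source. -/
def div (a b : Arr) (h : G.s a = G.s b) : Arr := G.mul a (G.inv b) (h.trans (G.t_inv b).symm)

theorem div_mul_div (a b c : Arr) (hab : G.s a = G.s b) (hbc : G.s b = G.s c)
    (h : G.s (G.div a b hab) = G.t (G.div b c hbc)) :
    G.mul (G.div a b hab) (G.div b c hbc) h = G.div a c (hab.trans hbc) := by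
  unfold div
  rw [G.mul_assoc a (G.inv b) _ (hab.trans (G.t_inv b).symm)
    ((G.s_inv b).trans (G.t_mul _ _ _).symm)]
  refine G.mul_congr' rfl ?_ _ _
  rw [← G.mul_assoc (G.inv b) b (G.inv c) (G.s_inv b) (hbc.trans (G.t_inv c).symm)]
  have e : G.one (G.s b) = G.one (G.t (G.inv c)) := by rw [hbc, G.t_inv]
  exact (G.mul_congr' ((G.inv_mul b).trans e) rfl _ (G.s_one _)).trans (G.one_mul _)

theorem mul_div_cancel (a b : Arr) (h : G.s a = G.t b) (h' : G.s (G.mul a b h) = G.s b) :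
    G.div (G.mul a b h) b h' = a := by
  unfold div
  rw [G.mul_assoc a b (G.inv b) h (G.t_inv b).symm]
  exact (G.mul_congr' rfl ((G.mul_inv b).trans (congrArg G.one h.symm)) _
    (G.t_one _).symm).trans (G.mul_one a)

theorem div_one (a : Arr) (y : Ob) (h : G.s a = G.s (G.one y)) : G.div a (G.one y) h = a := by
  have hy : G.s a = y := h.trans (G.s_one y)
  have hc : G.s a = G.t (G.one y) := hy.trans (G.t_one y).symm
  have e : G.mul a (G.one y) hc = a :=
    (G.mul_congr' rfl (congrArg G.one hy.symm) _ (G.t_one _).symm).trans (G.mul_one a)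
  simpa only [e] using G.mul_div_cancel a (G.one y) hc (G.s_mul _ _ _)

end GroupoidStr

namespace LieGroupoid

variable (G : LieGroupoid m g M Γ)

/-- The simplex of the nerve of `Γ ⇉ Γ ⇉ M` with edges `g_ij = a_j a_i⁻¹`, for arrows
`a_0, …, a_q` with the same source. -/
def nerveOfCone {q : ℕ} (a : Fin (q + 1) → Γ) (h : ∀ i j, G.s (a i) = G.s (a j)) :
    G.toTwoGroupoid.Nerve q where
  vertex i := G.t (a i)
  edge i j _ := G.div (a j) (a i) (h j i)
  tri i _ k _ _ := G.div (a k) (a i) (h k i)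
  s_edge _ _ _ := (G.s_mul _ _ _).trans (G.s_inv _)
  t_edge _ _ _ := G.t_mul _ _ _
  u_tri i j k _ _ := (G.div_mul_div (a k) (a j) (a i) (h k j) (h j i) _).symm
  l_tri _ _ _ _ _ := rfl
  tetra i j k l _ _ _ c₁ _ c₃ _ :=
    (G.div_mul_div (a l) (a k) (a i) (h l k) (h k i) c₁).trans
      (G.div_mul_div (a l) (a j) (a i) (h l j) (h j i) c₃).symm

/-- A simplex of the nerve of `Γ ⇉ Γ ⇉ M` is determined by its vertices and edges, since its
2-arrows are identities. -/
theorem nerve_ext {q : ℕ} {x y : G.toTwoGroupoid.Nerve q} (hv : x.vertex = y.vertex)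
    (he : x.edge = y.edge) : x = y := by
  refine TwoGroupoid.Nerve.ext hv he ?_
  funext i j k hij hjk
  have hx : x.tri i j k hij hjk = x.edge i k (hij.trans hjk) := x.l_tri i j k hij hjk
  have hy : y.tri i j k hij hjk = y.edge i k (hij.trans hjk) := y.l_tri i j k hij hjk
  rw [hx, hy, he]

theorem isPlot_nerve_iff {q n : ℕ} {P : EuclideanSpace ℝ (Fin n) → G.toTwoGroupoid.Nerve q} :
    IsPlot P ↔ (∀ i, ContMDiff (𝓡 n) (𝓡 m) ∞ fun x => (P x).vertex i) ∧
      ∀ i j h, ContMDiff (𝓡 n) (𝓡 g) ∞ fun x => (P x).edge i j h := by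
  refine ⟨fun h => ⟨h.1, h.2.1⟩, fun h => ⟨h.1, h.2, fun i j k hij hjk => ?_⟩⟩
  have e : (fun x => (P x).tri i j k hij hjk) = fun x => (P x).edge i k (hij.trans hjk) :=
    funext fun x => (P x).l_tri i j k hij hjk
  rw [e]
  exact h.2 i k _

theorem isPlot_nerveOfCone {q n : ℕ} {a : Fin (q + 1) → EuclideanSpace ℝ (Fin n) → Γ}
    (ha : ∀ i, ContMDiff (𝓡 n) (𝓡 g) ∞ (a i)) (h : ∀ y i j, G.s (a i y) = G.s (a j y)) :
    IsPlot fun y => G.nerveOfCone (fun i => a i y) (h y) :=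
  G.isPlot_nerve_iff.2 ⟨fun i => G.submersion_t.contMDiff.comp (ha i),
    fun i j _ => G.smooth_mul n _ _ _ (ha j) (G.smooth_inv.comp (ha i))⟩

end LieGroupoid

namespace CentralExtension

variable {Gt : LieGroupoid m k M Γt} {G : LieGroupoid m g M Γ} (ext : CentralExtension Gt G)

theorem φ_div (a b : Γt) (h : Gt.s a = Gt.s b) (h' : G.s (ext.φ a) = G.s (ext.φ b)) :
    ext.φ (Gt.div a b h) = G.div (ext.φ a) (ext.φ b) h' := by
  unfold GroupoidStr.div
  rw [ext.φ_functor.map_mul _ _ _ (ext.φ_composable (h.trans (Gt.t_inv b).symm))]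
  exact G.mul_congr' rfl (ext.φ_functor.map_inv b) _ _

/-- Plots of the nerve of `Γ ⇉ Γ ⇉ M` lift locally to the nerve of `Γt ⇉ Γt ⇉ M`: lift the edges
`g_0i` to `a_i`, take for `a_0` the unit at the vertex `0`, and use the edges `a_j a_i⁻¹`. -/
theorem hasLocalLifts_nerve [IsManifold (𝓡 k) ∞ Γt] [IsManifold (𝓡 g) ∞ Γ] (q : ℕ) :
    HasLocalLifts (ext.φGroupoidHom.nerve q) := by
  intro n P x
  have hPv : ∀ i, ContMDiff (𝓡 n) (𝓡 m) ∞ fun y => (P.1 y).vertex i := (G.isPlot_nerve_iff.1 P.2).1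
  have hPe : ∀ i j h, ContMDiff (𝓡 n) (𝓡 g) ∞ fun y => (P.1 y).edge i j h :=
    (G.isPlot_nerve_iff.1 P.2).2
  have hlift : ∀ i : Fin (q + 1), ∃ a : EuclideanSpace ℝ (Fin n) → Γt,
      ContMDiff (𝓡 n) (𝓡 k) ∞ a ∧ ∀ᶠ y in 𝓝 x, Gt.s (a y) = (P.1 y).vertex 0 ∧
        Gt.t (a y) = (P.1 y).vertex i ∧ (∀ h : 0 < i, ext.φ (a y) = (P.1 y).edge 0 i h) ∧
        (i = 0 → a y = Gt.one ((P.1 y).vertex 0)) := by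
    intro i
    by_cases hi : 0 < i
    · obtain ⟨a, ha, hφ⟩ := exists_lift_of_isSubmersion ext.φ_submersion ext.φ_surjective
        (hPe 0 i hi) x
      refine ⟨a, ha, ?_⟩
      filter_upwards [hφ] with y hy
      have hy' : ext.φ (a y) = (P.1 y).edge 0 i hi := hy
      refine ⟨?_, ?_, fun _ => hy', fun h => absurd h hi.ne'⟩
      · rw [← (P.1 y).s_edge 0 i hi, ← hy']
        exact (ext.φ_functor.map_s (a y)).symm
      · rw [← (P.1 y).t_edge 0 i hi, ← hy']
        exact (ext.φ_functor.map_t (a y)).symm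
    · have h0 : i = 0 := by simpa using hi
      subst h0
      exact ⟨fun y => Gt.one ((P.1 y).vertex 0), Gt.smooth_one.comp (hPv 0),
        Filter.Eventually.of_forall fun y =>
          ⟨Gt.s_one _, Gt.t_one _, fun h => absurd h hi, fun _ => rfl⟩⟩
  choose a ha hax using hlift
  obtain ⟨F, hF, hFU, hFx⟩ := exists_contDiff_eventuallyEq_id (Filter.eventually_all.2 hax)
  have hs : ∀ y i j, Gt.s (a i (F y)) = Gt.s (a j (F y)) := fun y i j =>
    (hFU y i).1.trans (hFU y j).1.symm
  have haF : ∀ i, ContMDiff (𝓡 n) (𝓡 k) ∞ fun y => a i (F y) := fun i => (ha i).comp hF.contMDiff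
  refine ⟨⟨fun y => Gt.nerveOfCone (fun i => a i (F y)) (hs y), Gt.isPlot_nerveOfCone haF hs⟩, ?_⟩
  filter_upwards [hFx] with y hy
  have hFy : F y = y := hy
  have key : ∀ i, Gt.s (a i y) = (P.1 y).vertex 0 ∧ Gt.t (a i y) = (P.1 y).vertex i ∧
      (∀ h : 0 < i, ext.φ (a i y) = (P.1 y).edge 0 i h) ∧
      (i = 0 → a i y = Gt.one ((P.1 y).vertex 0)) := hFy ▸ hFU y
  refine G.nerve_ext ?_ ?_
  · funext i
    change Gt.t (a i (F y)) = _
    rw [hFy, (key i).2.1]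
  · funext i j hij
    have hsφ : G.s (ext.φ (a j y)) = G.s (ext.φ (a i y)) := by
      rw [ext.φ_functor.map_s, ext.φ_functor.map_s, (key i).1, (key j).1]
    have e1 : ext.φ (Gt.div (a j (F y)) (a i (F y)) (hs y j i)) =
        G.div (ext.φ (a j y)) (ext.φ (a i y)) hsφ := by
      simp only [hFy]
      exact ext.φ_div _ _ _ _
    change ext.φ (Gt.div (a j (F y)) (a i (F y)) (hs y j i)) = _
    rw [e1]
    -- `φ a_j = g_ij (φ a_i)`, from the triangle `0 < i < j`, or because `a_0` is a unit
    have hc : G.s ((P.1 y).edge i j hij) = G.t (ext.φ (a i y)) := by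
      rw [(P.1 y).s_edge i j hij, ext.φ_functor.map_t, (key i).2.1]
      rfl
    have e2 : ext.φ (a j y) = G.mul ((P.1 y).edge i j hij) (ext.φ (a i y)) hc := by
      by_cases hi : 0 < i
      · have h1 := (P.1 y).u_tri 0 i j hi hij
        have h2 : (P.1 y).tri 0 i j hi hij = (P.1 y).edge 0 j (hi.trans hij) :=
          (P.1 y).l_tri 0 i j hi hij
        rw [(key j).2.2.1 (hi.trans hij), ← h2]
        exact h1.trans (G.mul_congr' rfl ((key i).2.2.1 hi).symm _ _)
      · have h0 : i = 0 := by simpa using hi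
        subst h0
        rw [(key j).2.2.1 hij]
        have hu : ext.φ (a 0 y) = G.one (G.s ((P.1 y).edge 0 j hij)) := by
          rw [(key 0).2.2.2 rfl, ext.φ_functor.map_one]
          exact congrArg G.one ((P.1 y).s_edge 0 j hij).symm
        exact (G.mul_one _).symm.trans (G.mul_congr' rfl hu.symm _ _)
    have hd : G.s (G.mul ((P.1 y).edge i j hij) (ext.φ (a i y)) hc) = G.s (ext.φ (a i y)) :=
      G.s_mul _ _ _
    have e3 : G.div (ext.φ (a j y)) (ext.φ (a i y)) hsφ =
        G.div (G.mul ((P.1 y).edge i j hij) (ext.φ (a i y)) hc) (ext.φ (a i y)) hd := by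
      simp only [e2]
    rw [e3]
    exact G.mul_div_cancel _ _ _ _

end CentralExtension

end Lie

/-! ### Variation of a connection form along the fibres -/

section OneForms

variable {X : Type u} [DiffeologicalSpace X]

theorem Form.on_add (α : Form X 1) {n : ℕ} (P : Plot X n) (x a b : EuclideanSpace ℝ (Fin n)) :
    α.on P x (fun _ => a + b) = α.on P x (fun _ => a) + α.on P x (fun _ => b) := by
  have h := (α.on P x).map_update_add (fun _ => 0) 0 a b
  simp only [Function.update_eq_const_of_subsingleton] at h
  exact h

theorem Form.on_smul (α : Form X 1) {n : ℕ} (P : Plot X n) (x a : EuclideanSpace ℝ (Fin n))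
    (c : ℝ) : α.on P x (fun _ => c • a) = c * α.on P x (fun _ => a) := by
  have h := (α.on P x).map_update_smul (fun _ => 0) 0 c a
  simp only [Function.update_eq_const_of_subsingleton] at h
  exact h

theorem Form.on_reparam_apply (α : Form X 1) {m n : ℕ} (P : Plot X n)
    {F : EuclideanSpace ℝ (Fin m) → EuclideanSpace ℝ (Fin n)} (hF : ContDiff ℝ ∞ F)
    {x w : EuclideanSpace ℝ (Fin m)} {F' : EuclideanSpace ℝ (Fin m) →L[ℝ] EuclideanSpace ℝ (Fin n)}
    (hF' : HasFDerivAt F F' x) :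
    α.on (P.reparam F hF) x (fun _ => w) = α.on P (F x) (fun _ => F' w) := by
  rw [α.on_reparam, hF'.fderiv]
  rfl

end OneForms

/-- The angular form along a map to the circle is the derivative of a local argument. -/
theorem fderiv_arg_mul {n : ℕ} {p : EuclideanSpace ℝ (Fin n) → Circle}
    {x : EuclideanSpace ℝ (Fin n)} (hp : DifferentiableAt ℝ (fun y => (p y : ℂ)) x)
    (w : EuclideanSpace ℝ (Fin n)) :
    fderiv ℝ (fun y => Complex.arg (((p x)⁻¹ * p y : Circle) : ℂ)) x w =
      angularFun (fun y => (p y : ℂ)) x w := by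
  have hu : HasFDerivAt (fun y => (((p x)⁻¹ * p y : Circle) : ℂ))
      ((starRingEnd ℂ (p x : ℂ)) • fderiv ℝ (fun y => (p y : ℂ)) x) x := by
    have h := hp.hasFDerivAt.const_mul (starRingEnd ℂ (p x : ℂ))
    simpa only [Circle.coe_mul, Circle.coe_inv_eq_conj] using h
  have h1 : (((p x)⁻¹ * p x : Circle) : ℂ) = 1 := by simp
  have hlog := (Complex.hasStrictDerivAt_log (x := (((p x)⁻¹ * p x : Circle) : ℂ))
    (by rw [h1]; exact Complex.one_mem_slitPlane)).hasDerivAt.complexToReal_fderiv.comp x hu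
  have harg := Complex.imCLM.hasFDerivAt.comp x hlog
  have e : (fun y => Complex.arg (((p x)⁻¹ * p y : Circle) : ℂ)) =
      Complex.imCLM ∘ Complex.log ∘ fun y => (((p x)⁻¹ * p y : Circle) : ℂ) :=
    funext fun y => (Complex.log_im _).symm
  rw [e, harg.fderiv, h1, angularFun_apply]
  simp

theorem contDiffAt_arg {n : ℕ} {u : EuclideanSpace ℝ (Fin n) → ℂ} {x : EuclideanSpace ℝ (Fin n)}
    (hu : ContDiffAt ℝ ∞ u x) (hx : u x ∈ Complex.slitPlane) :
    ContDiffAt ℝ ∞ (fun y => Complex.arg (u y)) x := by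
  have h : ContDiffAt ℝ ∞ Complex.log (u x) :=
    (Complex.contDiffAt_log hx (n := ∞)).restrict_scalars ℝ
  have h2 := Complex.imCLM.contDiff.contDiffAt.comp x (h.comp x hu)
  simpa only [Function.comp_def, Complex.imCLM_apply, Complex.log_im] using h2

section Lie

variable {m g k : ℕ} {M : Type u} {Γ : Type v} {Γt : Type w}
  [TopologicalSpace M] [ChartedSpace (EuclideanSpace ℝ (Fin m)) M]
  [TopologicalSpace Γ] [ChartedSpace (EuclideanSpace ℝ (Fin g)) Γ]
  [TopologicalSpace Γt] [ChartedSpace (EuclideanSpace ℝ (Fin k)) Γt]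

namespace CentralExtension

variable {Gt : LieGroupoid m k M Γt} {G : LieGroupoid m g M Γ} (ext : CentralExtension Gt G)

theorem s_act (z : Circle) (γ : Γt) : Gt.s (ext.act z γ) = Gt.s γ :=
  (Gt.s_mul _ _ _).trans (ext.s_i _ _)

theorem act_act (z z' : Circle) (γ : Γt) : ext.act z (ext.act z' γ) = ext.act (z' * z) γ := by
  have h : ext.act z (ext.act z' γ) = Gt.mul (ext.act z' γ) (ext.i (Gt.s γ, z))
      ((ext.s_act _ _).trans (ext.t_i _ _).symm) :=
    Gt.mul_congr' rfl (by rw [ext.s_act]) _ _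
  rw [h]
  refine (Gt.mul_assoc _ _ _ (ext.t_i _ _).symm ((ext.s_i _ _).trans (ext.t_i _ _).symm)).trans ?_
  exact Gt.mul_congr' rfl (ext.i_mul _ _ _) _ _

theorem act_diff (a : ext.FibreProduct) : ext.act (ext.diff a) a.1.2 = a.1.1 :=
  (ext.central a.1.2 (ext.diff a) (ext.s_i _ _) (ext.t_i _ _).symm).symm.trans (ext.diff_spec a)

theorem contMDiff_act {n : ℕ} {P : EuclideanSpace ℝ (Fin n) → Γt}
    {z : EuclideanSpace ℝ (Fin n) → Circle} (hP : ContMDiff (𝓡 n) (𝓡 k) ∞ P)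
    (hz : ContMDiff (𝓡 n) (𝓡 1) ∞ z) : ContMDiff (𝓡 n) (𝓡 k) ∞ fun y => ext.act (z y) (P y) :=
  Gt.smooth_mul n _ _ _ hP
    (ext.i_embedding.contMDiff.comp ((Gt.submersion_s.contMDiff.comp hP).prodMk hz))

variable {ext}

theorem IsConnection.on_act_const {θ : ManifoldForm k Γt 1} (hθ : ext.IsConnection θ) {n : ℕ}
    (P : @Plot Γt (manifoldDiffeology k Γt) n) (z : Circle) (x : EuclideanSpace ℝ (Fin n)) :
    @Form.on Γt (manifoldDiffeology k Γt) 1 n θ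
        (@Plot.push Γt Γt (manifoldDiffeology k Γt) (manifoldDiffeology k Γt) n P (ext.act z)
          (ext.dSmooth_act z)) x =
      @Form.on Γt (manifoldDiffeology k Γt) 1 n θ P x := by
  let _ := manifoldDiffeology k Γt
  exact congrArg (fun η : Form Γt 1 => η.on P x) (hθ.invariant z)

/-- A connection form on a curve `γ · z(τ)` in a fixed orbit is the angular form on `z`: up to the
invariant action of `z(0)`, this is a reparametrization of the curve `γ · e^(iτ)`. -/
theorem IsConnection.on_orbit {θ : ManifoldForm k Γt 1} (hθ : ext.IsConnection θ) {n : ℕ} (γ : Γt)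
    {z : EuclideanSpace ℝ (Fin n) → Circle} (hz : ContMDiff (𝓡 n) (𝓡 1) ∞ z)
    (x w : EuclideanSpace ℝ (Fin n)) :
    @Form.on Γt (manifoldDiffeology k Γt) 1 n θ
        ⟨fun y => ext.act (z y) γ, ext.contMDiff_act contMDiff_const hz⟩ x (fun _ => w) =
      angularFun (fun y => (z y : ℂ)) x w := by
  let _ := manifoldDiffeology k Γt
  have hzc : ContDiff ℝ ∞ fun y => (z y : ℂ) := contDiff_coe_circle hz
  let u : EuclideanSpace ℝ (Fin n) → Circle := fun y => (z x)⁻¹ * z y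
  have hu : ContDiff ℝ ∞ fun y => (u y : ℂ) := by
    simp only [u, Circle.coe_mul]
    exact contDiff_const.mul hzc
  have hU : {y | (u y : ℂ) ∈ Complex.slitPlane} ∈ 𝓝 x := by
    refine (Complex.isOpen_slitPlane.preimage hu.continuous).mem_nhds ?_
    simp [u]
  obtain ⟨F, hF, hFU, hFx⟩ := exists_contDiff_eventuallyEq_id hU
  have ha : ContDiff ℝ ∞ fun y => Complex.arg (u (F y) : ℂ) :=
    contDiff_iff_contDiffAt.2 fun y => contDiffAt_arg (hu.comp hF).contDiffAt (hFU y)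
  let τ : EuclideanSpace ℝ (Fin n) → EuclideanSpace ℝ (Fin 1) := fun y =>
    Complex.arg (u (F y) : ℂ) • EuclideanSpace.single 0 1
  have hτ : ContDiff ℝ ∞ τ := ha.smul contDiff_const
  have hgerm : (fun y => ext.act (z y) γ) =ᶠ[𝓝 x]
      ext.act (z x) ∘ ((ext.orbit γ).reparam τ hτ).1 := by
    filter_upwards [hFx] with y hy
    have hy' : F y = y := hy
    change ext.act (z y) γ = ext.act (z x) (ext.act (Circle.exp (τ y 0)) γ)
    have h1 : τ y 0 = Complex.arg (u y : ℂ) := by simp [τ, hy']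
    rw [h1, Circle.exp_arg, ext.act_act]
    congr 1
    simp only [u]
    rw [mul_comm, mul_inv_cancel_left]
  have h0 : τ x = 0 := by
    have : F x = x := hFx.self_of_nhds
    simp [τ, this, u]
  have hτ' := ((ha.differentiable (by simp) x).hasFDerivAt).smul_const
    (EuclideanSpace.single (0 : Fin 1) (1 : ℝ))
  have hd : fderiv ℝ (fun y => Complex.arg (u (F y) : ℂ)) x w =
      angularFun (fun y => (z y : ℂ)) x w := by
    have e : (fun y => Complex.arg (u (F y) : ℂ)) =ᶠ[𝓝 x] fun y => Complex.arg (u y : ℂ) := by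
      filter_upwards [hFx] with y hy
      rw [hy, id]
    rw [e.fderiv_eq]
    exact fderiv_arg_mul (hzc.differentiable (by simp) x) w
  have e1 := Form.on_congr (X := Γt) θ
    (P := ⟨fun y => ext.act (z y) γ, ext.contMDiff_act contMDiff_const hz⟩)
    (Q := ((ext.orbit γ).reparam τ hτ).push (ext.act (z x)) (ext.dSmooth_act (z x))) hgerm
  have e2 := hθ.on_act_const ((ext.orbit γ).reparam τ hτ) (z x) x
  -- `τ` vanishes at `x`, where the velocity of the orbit is normalized
  rw [e1, e2, Form.on_reparam_apply (X := Γt) θ (ext.orbit γ) hτ hτ', h0]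
  simp only [ContinuousLinearMap.smulRight_apply]
  rw [Form.on_smul (X := Γt) θ, hθ.normalized, mul_one, hd]

/-- The change of a connection form under a variable element of the circle:
`θ(P · z) = θ(P) + z^* dt`. This is the Leibniz rule for the map `(τ, τ') ↦ P(τ) · z(τ')` on the
diagonal. -/
theorem IsConnection.on_act {θ : ManifoldForm k Γt 1} (hθ : ext.IsConnection θ) {n : ℕ}
    {P : EuclideanSpace ℝ (Fin n) → Γt} (hP : ContMDiff (𝓡 n) (𝓡 k) ∞ P)
    {z : EuclideanSpace ℝ (Fin n) → Circle} (hz : ContMDiff (𝓡 n) (𝓡 1) ∞ z)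
    (x w : EuclideanSpace ℝ (Fin n)) :
    @Form.on Γt (manifoldDiffeology k Γt) 1 n θ
        ⟨fun y => ext.act (z y) (P y), ext.contMDiff_act hP hz⟩ x (fun _ => w) =
      @Form.on Γt (manifoldDiffeology k Γt) 1 n θ ⟨P, hP⟩ x (fun _ => w) +
        angularFun (fun y => (z y : ℂ)) x w := by
  let _ := manifoldDiffeology k Γt
  -- It suffices to evaluate on the line `ℓ t = x + t w`. The map
  -- `R` of the plane is `z` acting on `P` along the diagonal; on the first axis `z` is constant, on
  -- the second axis `P` is.
  have hl : ∀ (d : ℕ) (j : Fin d), HasFDerivAt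
      (fun y : EuclideanSpace ℝ (Fin d) => x + y j • w)
      ((EuclideanSpace.proj (𝕜 := ℝ) j : EuclideanSpace ℝ (Fin d) →L[ℝ] ℝ).smulRight w) 0 :=
    fun d j => ((EuclideanSpace.proj (𝕜 := ℝ) j).smulRight w).hasFDerivAt.const_add x
  have hlc : ∀ (d : ℕ) (j : Fin d), ContDiff ℝ ∞ (fun y : EuclideanSpace ℝ (Fin d) => x + y j • w) :=
    fun d j => contDiff_const.add ((EuclideanSpace.proj (𝕜 := ℝ) j).smulRight w).contDiff
  have hc : ∀ c : EuclideanSpace ℝ (Fin 2), ∃ L : EuclideanSpace ℝ (Fin 1) →L[ℝ]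
      EuclideanSpace ℝ (Fin 2), ∀ y, L y = y 0 • c :=
    fun c => ⟨(EuclideanSpace.proj (𝕜 := ℝ) 0).smulRight c, fun _ => rfl⟩
  let e₀ : EuclideanSpace ℝ (Fin 2) := EuclideanSpace.single 0 1
  let e₁ : EuclideanSpace ℝ (Fin 2) := EuclideanSpace.single 1 1
  obtain ⟨D, hD⟩ := hc (e₀ + e₁)
  obtain ⟨I₀, hI₀⟩ := hc e₀
  obtain ⟨I₁, hI₁⟩ := hc e₁
  let e : EuclideanSpace ℝ (Fin 1) := EuclideanSpace.single 0 1
  have he : e 0 = 1 := by simp [e]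
  let R : Plot Γt 2 := ⟨fun y => ext.act (z (x + y 1 • w)) (P (x + y 0 • w)),
    ext.contMDiff_act (hP.comp (hlc 2 0).contMDiff) (hz.comp (hlc 2 1).contMDiff)⟩
  let ℓ : EuclideanSpace ℝ (Fin 1) → EuclideanSpace ℝ (Fin n) := fun y => x + y 0 • w
  have hℓ : ContDiff ℝ ∞ ℓ := hlc 1 0
  have hℓ0 : ℓ 0 = x := by simp [ℓ]
  have along : ∀ Q : Plot Γt n, θ.on Q x (fun _ => w) = θ.on (Q.reparam ℓ hℓ) 0 (fun _ => e) := by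
    intro Q
    rw [Form.on_reparam_apply (X := Γt) θ Q hℓ (hl 1 0), hℓ0]
    simp [he]
  have lin : ∀ L : EuclideanSpace ℝ (Fin 1) →L[ℝ] EuclideanSpace ℝ (Fin 2),
      θ.on (R.reparam L L.contDiff) 0 (fun _ => e) = θ.on R 0 (fun _ => L e) := by
    intro L
    rw [Form.on_reparam_apply (X := Γt) θ R L.contDiff L.hasFDerivAt, map_zero]
  have hsum : θ.on (R.reparam D D.contDiff) 0 (fun _ => e) =
      θ.on (R.reparam I₀ I₀.contDiff) 0 (fun _ => e) +
        θ.on (R.reparam I₁ I₁.contDiff) 0 (fun _ => e) := by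
    rw [lin, lin, lin, ← Form.on_add (X := Γt) θ, hD, hI₀, hI₁, smul_add]
  have hRD : R.reparam D D.contDiff = Plot.reparam (X := Γt)
      ⟨fun y => ext.act (z y) (P y), ext.contMDiff_act hP hz⟩ ℓ hℓ := by
    refine Subtype.ext (funext fun y => ?_)
    change ext.act (z (x + D y 1 • w)) (P (x + D y 0 • w)) = ext.act (z (ℓ y)) (P (ℓ y))
    simp [hD, e₀, e₁, ℓ]
  have hRI₀ : R.reparam I₀ I₀.contDiff =
      (Plot.reparam (X := Γt) ⟨P, hP⟩ ℓ hℓ).push (ext.act (z x)) (ext.dSmooth_act (z x)) := by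
    refine Subtype.ext (funext fun y => ?_)
    change ext.act (z (x + I₀ y 1 • w)) (P (x + I₀ y 0 • w)) = ext.act (z x) (P (ℓ y))
    simp [hI₀, e₀, ℓ]
  have hRI₁ : R.reparam I₁ I₁.contDiff = Plot.reparam (X := Γt)
      ⟨fun y => ext.act (z y) (P x), ext.contMDiff_act contMDiff_const hz⟩ ℓ hℓ := by
    refine Subtype.ext (funext fun y => ?_)
    change ext.act (z (x + I₁ y 1 • w)) (P (x + I₁ y 0 • w)) = ext.act (z (ℓ y)) (P x)
    simp [hI₁, e₁, ℓ]
  rw [hRD, ← along, hRI₀, hRI₁, ← along, hθ.on_orbit (P x) hz,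
    hθ.on_act_const (Plot.reparam (X := Γt) ⟨P, hP⟩ ℓ hℓ) (z x), ← along] at hsum
  exact hsum

/-- On the fibre product, a connection form satisfies `pr₁^* θ = pr₂^* θ + f^* dt`, where `f` sends
`(γ₁, γ₂)` to `γ₁ γ₂⁻¹`. -/
theorem IsConnection.pullback_pr₁ {θ : ManifoldForm k Γt 1} (hθ : ext.IsConnection θ) :
    @Form.pullback ext.FibreProduct Γt ext.fibreDiffeology (manifoldDiffeology k Γt) ext.pr₁
        ext.dSmooth_pr₁ 1 θ =
      @Form.pullback ext.FibreProduct Γt ext.fibreDiffeology (manifoldDiffeology k Γt) ext.pr₂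
        ext.dSmooth_pr₂ 1 θ +
      @Form.pullback ext.FibreProduct Circle ext.fibreDiffeology (manifoldDiffeology 1 Circle)
        ext.diff ext.diff_smooth 1 angularForm := by
  let _ := manifoldDiffeology k Γt
  let _ := manifoldDiffeology 1 Circle
  let _ := ext.fibreDiffeology
  ext n A x v
  have hP₁ : ContMDiff (𝓡 n) (𝓡 k) ∞ (ext.pr₁ ∘ A.1) := ext.dSmooth_pr₁ n A.1 A.2
  have hP₂ : ContMDiff (𝓡 n) (𝓡 k) ∞ (ext.pr₂ ∘ A.1) := ext.dSmooth_pr₂ n A.1 A.2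
  have hz : ContMDiff (𝓡 n) (𝓡 1) ∞ (ext.diff ∘ A.1) := ext.diff_smooth n A.1 A.2
  have hv : v = fun _ => v 0 := funext fun i => by rw [Subsingleton.elim i 0]
  have e : A.push ext.pr₁ ext.dSmooth_pr₁ = (⟨fun y => ext.act ((ext.diff ∘ A.1) y)
      ((ext.pr₂ ∘ A.1) y), ext.contMDiff_act hP₂ hz⟩ : Plot Γt n) :=
    Subtype.ext (funext fun y => (ext.act_diff (A.1 y)).symm)
  have h := hθ.on_act hP₂ hz x (v 0)
  change θ.on (A.push ext.pr₁ ext.dSmooth_pr₁) x v =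
    θ.on (A.push ext.pr₂ ext.dSmooth_pr₂) x v + angularFun (fun y => (ext.diff (A.1 y) : ℂ)) x (v 0)
  rw [e, hv]
  exact h

end CentralExtension

end Lie

/-! ### The total differential of a form on 1-arrows -/

namespace TwoGroupoid

variable (G : TwoGroupoid.{u, v, w})

/-- The pullback to `N_q G` of a form on `Γ₁` along the edge `i < j`. -/
noncomputable def edgeForm (q : ℕ) (i j : Fin (q + 1)) (h : i < j) {p : ℕ} (θ : Form G.One p) :
    Form (G.Nerve q) p :=
  Form.pullback (fun x : G.Nerve q => x.edge i j h) (G.dSmooth_edge q i j h) p θ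

/-- `∂θ = -(g₁₂^* θ - g₀₂^* θ + g₀₁^* θ)` for a 1-form `θ` on 1-arrows. -/
theorem simpD_edgeForm (θ : Form G.One 1) :
    G.simpD 1 1 (G.edgeForm 1 0 1 (by decide) θ) =
      -(G.edgeForm 2 1 2 (by decide) θ - G.edgeForm 2 0 2 (by decide) θ +
        G.edgeForm 2 0 1 (by decide) θ) := by
  have h : G.simpD 1 1 (G.edgeForm 1 0 1 (by decide) θ) =
      (-1 : ℝ) ^ 1 • ((-1 : ℝ) ^ 0 • G.edgeForm 2 1 2 (by decide) θ +
        (-1 : ℝ) ^ 1 • G.edgeForm 2 0 2 (by decide) θ +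
        (-1 : ℝ) ^ 2 • G.edgeForm 2 0 1 (by decide) θ) := by
    rw [simpD, Fin.sum_univ_three]
    rfl
  rw [h]
  module

/-- The de Rham differential and the simplicial differential anticommute. -/
theorem d_simpD (p q : ℕ) (α : Form (G.Nerve q) p) :
    Form.d p (G.simpD p q α) + G.simpD (p + 1) q (Form.d p α) = 0 := by
  have h : ∀ r : Fin (q + 2),
      Form.d p (Form.pullback (face (G := G) r) (dSmooth_face r) p α) =
        Form.pullback (face (G := G) r) (dSmooth_face r) (p + 1) (Form.d p α) := fun _ => rfl
  simp only [simpD, LinearMap.smul_apply, LinearMap.sum_apply, map_smul, map_sum, h]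
  rw [pow_succ]
  module

/-- `∂∂θ = 0` for a 1-form `θ` on 1-arrows. -/
theorem simpD_simpD_edgeForm (θ : Form G.One 1) :
    G.simpD 1 2 (G.simpD 1 1 (G.edgeForm 1 0 1 (by decide) θ)) = 0 := by
  rw [simpD_edgeForm]
  have h : ∀ (i j : Fin 3) (hij : i < j), G.simpD 1 2 (G.edgeForm 2 i j hij θ) =
      (-1 : ℝ) ^ 1 • ((-1 : ℝ) ^ 0 • G.edgeForm 3 (Fin.succAbove 0 i) (Fin.succAbove 0 j)
          (Fin.succAbove_lt_succAbove_iff.2 hij) θ +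
        (-1 : ℝ) ^ 1 • G.edgeForm 3 (Fin.succAbove 1 i) (Fin.succAbove 1 j)
          (Fin.succAbove_lt_succAbove_iff.2 hij) θ +
        (-1 : ℝ) ^ 2 • G.edgeForm 3 (Fin.succAbove 2 i) (Fin.succAbove 2 j)
          (Fin.succAbove_lt_succAbove_iff.2 hij) θ +
        (-1 : ℝ) ^ 3 • G.edgeForm 3 (Fin.succAbove 3 i) (Fin.succAbove 3 j)
          (Fin.succAbove_lt_succAbove_iff.2 hij) θ) := by
    intro i j hij
    rw [simpD, Fin.sum_univ_four]
    rfl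
  have h12 : G.simpD 1 2 (G.edgeForm 2 1 2 (by decide) θ) =
      (-1 : ℝ) ^ 1 • ((-1 : ℝ) ^ 0 • G.edgeForm 3 2 3 (by decide) θ +
        (-1 : ℝ) ^ 1 • G.edgeForm 3 2 3 (by decide) θ +
        (-1 : ℝ) ^ 2 • G.edgeForm 3 1 3 (by decide) θ +
        (-1 : ℝ) ^ 3 • G.edgeForm 3 1 2 (by decide) θ) := h 1 2 _
  have h02 : G.simpD 1 2 (G.edgeForm 2 0 2 (by decide) θ) =
      (-1 : ℝ) ^ 1 • ((-1 : ℝ) ^ 0 • G.edgeForm 3 1 3 (by decide) θ +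
        (-1 : ℝ) ^ 1 • G.edgeForm 3 0 3 (by decide) θ +
        (-1 : ℝ) ^ 2 • G.edgeForm 3 0 3 (by decide) θ +
        (-1 : ℝ) ^ 3 • G.edgeForm 3 0 2 (by decide) θ) := h 0 2 _
  have h01 : G.simpD 1 2 (G.edgeForm 2 0 1 (by decide) θ) =
      (-1 : ℝ) ^ 1 • ((-1 : ℝ) ^ 0 • G.edgeForm 3 1 2 (by decide) θ +
        (-1 : ℝ) ^ 1 • G.edgeForm 3 0 2 (by decide) θ +
        (-1 : ℝ) ^ 2 • G.edgeForm 3 0 1 (by decide) θ +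
        (-1 : ℝ) ^ 3 • G.edgeForm 3 0 1 (by decide) θ) := h 0 1 _
  rw [map_neg, map_add, map_sub, h12, h02, h01]
  module

variable {G}

/-- The cochain of total degree `3` with given components of bidegrees `(1, 2)` and `(2, 1)`, the
other components being zero. -/
noncomputable def mkThree (α : Form (G.Nerve 2) 1) (β : Form (G.Nerve 1) 2) : G.TotalForm 3
  | ⟨(1, 2), _⟩ => α
  | ⟨(2, 1), _⟩ => β
  | _ => 0

theorem forall_totalForm_three {p : {a : ℕ × ℕ // a.1 + a.2 = 3} → Prop}
    (h₀ : p ⟨(0, 3), rfl⟩) (h₁ : p ⟨(1, 2), rfl⟩) (h₂ : p ⟨(2, 1), rfl⟩) (h₃ : p ⟨(3, 0), rfl⟩) :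
    ∀ a, p a := by
  rintro ⟨⟨a, b⟩, h⟩
  have h' : a + b = 3 := h
  obtain ⟨rfl, rfl⟩ | ⟨rfl, rfl⟩ | ⟨rfl, rfl⟩ | ⟨rfl, rfl⟩ :
      (a = 0 ∧ b = 3) ∨ (a = 1 ∧ b = 2) ∨ (a = 2 ∧ b = 1) ∨ (a = 3 ∧ b = 0) := by omega
  exacts [h₀, h₁, h₂, h₃]

theorem totalD_ofOneArrows (θ : Form G.One 1) :
    G.totalD 2 (G.ofOneArrows θ) =
      mkThree (G.simpD 1 1 (G.edgeForm 1 0 1 (by decide) θ))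
        (G.edgeForm 1 0 1 (by decide) (Form.d 1 θ)) := by
  funext a
  revert a
  refine forall_totalForm_three ?_ ?_ ?_ ?_
  · change (0 : Form _ 0) + G.simpD 0 2 0 = 0
    rw [map_zero, add_zero]
  · change Form.d 0 (0 : Form _ 0) + G.simpD 1 1 (G.edgeForm 1 0 1 (by decide) θ) = _
    exact (congrArg (· + G.simpD 1 1 (G.edgeForm 1 0 1 (by decide) θ)) (map_zero _)).trans
      (zero_add _)
  · change Form.d 1 (G.edgeForm 1 0 1 (by decide) θ) + G.simpD 2 0 0 = _
    rw [map_zero, add_zero]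
    rfl
  · exact (add_zero _).trans (map_zero (Form.d 2))

theorem totalD_mkThree (α : Form (G.Nerve 2) 1) (β : Form (G.Nerve 1) 2)
    (h₁ : G.simpD 1 2 α = 0) (h₂ : Form.d 1 α + G.simpD 2 1 β = 0) (h₃ : Form.d 2 β = 0) :
    G.totalD 3 (mkThree α β) = 0 := by
  funext ⟨⟨p, q⟩, h⟩
  have h' : p + q = 4 := h
  obtain ⟨rfl, rfl⟩ | ⟨rfl, rfl⟩ | ⟨rfl, rfl⟩ | ⟨rfl, rfl⟩ | ⟨rfl, rfl⟩ :
      (p = 0 ∧ q = 4) ∨ (p = 1 ∧ q = 3) ∨ (p = 2 ∧ q = 2) ∨ (p = 3 ∧ q = 1) ∨ (p = 4 ∧ q = 0) := by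
    omega
  · change (0 : Form _ 0) + G.simpD 0 3 0 = 0
    rw [map_zero, add_zero]
  · change Form.d 0 (0 : Form _ 0) + G.simpD 1 2 α = 0
    rw [h₁, map_zero, add_zero]
  · exact h₂
  · change Form.d 2 β + G.simpD 3 0 0 = 0
    rw [h₃, map_zero, add_zero]
  · change Form.d 3 (0 : Form _ 3) + 0 = 0
    rw [map_zero, add_zero]

theorem totalD_totalD_ofOneArrows (θ : Form G.One 1) :
    G.totalD 3 (G.totalD 2 (G.ofOneArrows θ)) = 0 := by
  rw [totalD_ofOneArrows]
  refine totalD_mkThree _ _ (G.simpD_simpD_edgeForm θ) ?_ ?_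
  · exact G.d_simpD 1 1 (G.edgeForm 1 0 1 (by decide) θ)
  · exact Form.d_d (G.edgeForm 1 0 1 (by decide) θ)

end TwoGroupoid

theorem TwoGroupoid.Hom.pullback_injective {G : TwoGroupoid.{u, v, w}} {H : TwoGroupoid} (F : G.Hom H)
    (h : ∀ q, HasLocalLifts (F.nerve q)) (n : ℕ) : Function.Injective (F.pullback n) :=
  fun _ _ hab => funext fun a =>
    Form.pullback_injective (F.dSmooth_nerve _) (h _) (congrFun hab a)

/-! ### Construction of the cocycle and comparison of the classes -/

theorem forall_fin_three_lt {p : ∀ i j : Fin 3, i < j → Prop} (h₀₁ : p 0 1 (by decide))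
    (h₀₂ : p 0 2 (by decide)) (h₁₂ : p 1 2 (by decide)) : ∀ i j h, p i j h := by
  intro i j h
  fin_cases i <;> fin_cases j <;> first | assumption | exact absurd h (by decide)

section Lie

variable {m g k : ℕ} {M : Type u} {Γ : Type v} {Γt : Type w}
  [TopologicalSpace M] [ChartedSpace (EuclideanSpace ℝ (Fin m)) M]
  [TopologicalSpace Γ] [ChartedSpace (EuclideanSpace ℝ (Fin g)) Γ]
  [TopologicalSpace Γt] [ChartedSpace (EuclideanSpace ℝ (Fin k)) Γt]

/-- The edges of a triangle in the nerve of `Γ ⇉ Γ ⇉ M` commute. -/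
theorem LieGroupoid.edge_eq_mul (G : LieGroupoid m g M Γ) {q : ℕ} (x : G.toTwoGroupoid.Nerve q)
    {i j l : Fin (q + 1)} (hij : i < j) (hjl : j < l) :
    x.edge i l (hij.trans hjl) = G.mul (x.edge j l hjl) (x.edge i j hij)
      ((x.s_edge j l hjl).trans (x.t_edge i j hij).symm) :=
  (x.l_tri i j l hij hjl).symm.trans (x.u_tri i j l hij hjl)

namespace CentralExtension

variable {Gt : LieGroupoid m k M Γt} {G : LieGroupoid m g M Γ} (ext : CentralExtension Gt G)

/-- For two plots of the nerve of `Γt ⇉ Γt ⇉ M` with the same image in the nerve of `Γ ⇉ Γ ⇉ M`,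
the plot of `Γt ×_Γ Γt` given by an edge. -/
def edgePair {q n : ℕ} {Q Q' : Plot (Gt.toTwoGroupoid.Nerve q) n}
    (h : ext.φGroupoidHom.nerve q ∘ Q.1 = ext.φGroupoidHom.nerve q ∘ Q'.1) (i j : Fin (q + 1))
    (hij : i < j) : @Plot ext.FibreProduct ext.fibreDiffeology n :=
  ⟨fun y => ⟨((Q.1 y).edge i j hij, (Q'.1 y).edge i j hij),
      congrArg (fun x : G.toTwoGroupoid.Nerve q => x.edge i j hij) (congrFun h y)⟩,
    ext.isPlot_iff.2 ⟨Q.2.2.1 i j hij, Q'.2.2.1 i j hij⟩⟩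

variable {ext}

theorem IsConnection.edgeForm_on {θ : ManifoldForm k Γt 1} (hθ : ext.IsConnection θ) {q n : ℕ}
    {Q Q' : Plot (Gt.toTwoGroupoid.Nerve q) n}
    (h : ext.φGroupoidHom.nerve q ∘ Q.1 = ext.φGroupoidHom.nerve q ∘ Q'.1) (i j : Fin (q + 1))
    (hij : i < j) (x : EuclideanSpace ℝ (Fin n)) (v : Fin 1 → EuclideanSpace ℝ (Fin n)) :
    (Gt.toTwoGroupoid.edgeForm q i j hij θ).on Q x v =
      (Gt.toTwoGroupoid.edgeForm q i j hij θ).on Q' x v +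
        angularFun (fun y => (ext.diff ((ext.edgePair h i j hij).1 y) : ℂ)) x (v 0) :=
  congrArg (fun η : @Form ext.FibreProduct ext.fibreDiffeology 1 =>
    @Form.on _ ext.fibreDiffeology _ _ η (ext.edgePair h i j hij) x v) hθ.pullback_pr₁

/-- The curvature `dθ` descends: the angular form is closed. -/
theorem IsConnection.edgeForm_d_on {θ : ManifoldForm k Γt 1} (hθ : ext.IsConnection θ) {q n : ℕ}
    {Q Q' : Plot (Gt.toTwoGroupoid.Nerve q) n}
    (h : ext.φGroupoidHom.nerve q ∘ Q.1 = ext.φGroupoidHom.nerve q ∘ Q'.1) (i j : Fin (q + 1))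
    (hij : i < j) :
    (Gt.toTwoGroupoid.edgeForm q i j hij (@Form.d Γt (manifoldDiffeology k Γt) 1 θ)).on Q =
      (Gt.toTwoGroupoid.edgeForm q i j hij (@Form.d Γt (manifoldDiffeology k Γt) 1 θ)).on Q' := by
  let _ := manifoldDiffeology k Γt
  let _ := manifoldDiffeology 1 Circle
  let _ := ext.fibreDiffeology
  have h1 := congrArg (Form.d (X := ext.FibreProduct) 1) hθ.pullback_pr₁
  rw [map_add] at h1
  have h2 : Form.d 1 (Form.pullback ext.diff ext.diff_smooth 1 angularForm) = 0 :=
    (congrArg (Form.pullback ext.diff ext.diff_smooth 2) d_angularForm).trans (map_zero _)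
  rw [h2, add_zero] at h1
  exact congrArg (fun η : Form ext.FibreProduct 2 => η.on (ext.edgePair h i j hij)) h1

/-- `∂θ` descends: the circle-valued functions by which the edges differ are multiplicative. -/
theorem IsConnection.simpD_edgeForm_on {θ : ManifoldForm k Γt 1} (hθ : ext.IsConnection θ) {n : ℕ}
    {Q Q' : Plot (Gt.toTwoGroupoid.Nerve 2) n}
    (h : ext.φGroupoidHom.nerve 2 ∘ Q.1 = ext.φGroupoidHom.nerve 2 ∘ Q'.1) :
    (Gt.toTwoGroupoid.simpD 1 1 (Gt.toTwoGroupoid.edgeForm 1 0 1 (by decide) θ)).on Q =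
      (Gt.toTwoGroupoid.simpD 1 1 (Gt.toTwoGroupoid.edgeForm 1 0 1 (by decide) θ)).on Q' := by
  rw [TwoGroupoid.simpD_edgeForm]
  ext x v
  have hz : ∀ i j hij, ContDiff ℝ ∞ fun y => (ext.diff ((ext.edgePair h i j hij).1 y) : ℂ) :=
    fun i j hij => contDiff_coe_circle (ext.diff_smooth n _ (ext.edgePair h i j hij).2)
  have hmul : ∀ y, ext.diff ((ext.edgePair h 0 2 (by decide)).1 y) =
      ext.diff ((ext.edgePair h 1 2 (by decide)).1 y) *
        ext.diff ((ext.edgePair h 0 1 (by decide)).1 y) := by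
    intro y
    have hc : ext.horGroupoid.s ((ext.edgePair h 1 2 (by decide)).1 y) =
        ext.horGroupoid.t ((ext.edgePair h 0 1 (by decide)).1 y) :=
      ((Q.1 y).s_edge 1 2 _).trans ((Q.1 y).t_edge 0 1 _).symm
    refine Eq.trans (congrArg ext.diff ?_) (ext.fHom.hor₂.map_mul _ _ hc rfl)
    exact Subtype.ext (Prod.ext (Gt.edge_eq_mul (Q.1 y) (i := 0) (j := 1) (l := 2) _ _)
      (Gt.edge_eq_mul (Q'.1 y) (i := 0) (j := 1) (l := 2) _ _))
  have hang := congrArg (fun L : EuclideanSpace ℝ (Fin n) →L[ℝ] ℝ => L (v 0))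
    (angularFun_mul (hz 1 2 (by decide)) (hz 0 1 (by decide)) x)
  simp only [← hmul, _root_.add_apply] at hang
  have e12 := hθ.edgeForm_on h 1 2 (by decide) x v
  have e02 := hθ.edgeForm_on h 0 2 (by decide) x v
  have e01 := hθ.edgeForm_on h 0 1 (by decide) x v
  let E := fun (i j : Fin 3) (hij : i < j) (P : Plot (Gt.toTwoGroupoid.Nerve 2) n) =>
    (Gt.toTwoGroupoid.edgeForm 2 i j hij θ).on P x v
  change -(E 1 2 (by decide) Q - E 0 2 (by decide) Q + E 0 1 (by decide) Q) =
    -(E 1 2 (by decide) Q' - E 0 2 (by decide) Q' + E 0 1 (by decide) Q')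
  simp only [E]
  linarith

/-- The cochain `dθ + ∂θ` is the pullback of a cocycle. -/
theorem IsConnection.exists_isInducedCocycle [IsManifold (𝓡 k) ∞ Γt] [IsManifold (𝓡 g) ∞ Γ]
    {θ : ManifoldForm k Γt 1} (hθ : ext.IsConnection θ) :
    ∃ Om : G.toTwoGroupoid.cocycles 3, ext.IsInducedCocycle θ Om := by
  obtain ⟨α, hα⟩ := Form.exists_pullback_eq (ext.φGroupoidHom.dSmooth_nerve 2)
    (ext.hasLocalLifts_nerve 2) _ fun n Q Q' h => hθ.simpD_edgeForm_on h
  obtain ⟨β, hβ⟩ := Form.exists_pullback_eq (ext.φGroupoidHom.dSmooth_nerve 1)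
    (ext.hasLocalLifts_nerve 1) _ fun n Q Q' h => hθ.edgeForm_d_on h 0 1 (by decide)
  have hOm : ext.φGroupoidHom.pullback 3 (TwoGroupoid.mkThree α β) =
      Gt.toTwoGroupoid.totalD 2 (Gt.toTwoGroupoid.ofOneArrows θ) := by
    rw [TwoGroupoid.totalD_ofOneArrows]
    funext a
    revert a
    refine TwoGroupoid.forall_totalForm_three ?_ hα hβ ?_
    · exact map_zero (Form.pullback _ _ 0)
    · exact map_zero (Form.pullback _ _ 3)
  refine ⟨⟨TwoGroupoid.mkThree α β, ?_⟩, hOm⟩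
  refine LinearMap.mem_ker.2
    (ext.φGroupoidHom.pullback_injective ext.hasLocalLifts_nerve 4 ?_)
  rw [TwoGroupoid.Hom.pullback_totalD, hOm, TwoGroupoid.totalD_totalD_ofOneArrows, map_zero]

variable (ext)

/-- An edge of the nerve of `Γt ×_Γ Γt ⇉ Γt ⇉ M`, as an edge of the nerve of `Γt ⇉ Γt ⇉ M`. -/
def nerveOneToGroupoid (x : ext.twoGroupoid.Nerve 1) : Gt.toTwoGroupoid.Nerve 1 where
  vertex := x.vertex
  edge := x.edge
  tri i j l hij hjl := absurd hjl (by omega)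
  s_edge := x.s_edge
  t_edge := x.t_edge
  u_tri i j l hij hjl := absurd hjl (by omega)
  l_tri i j l hij hjl := absurd hjl (by omega)
  tetra i j l l' hij hjl := absurd hjl (by omega)

theorem dSmooth_nerveOneToGroupoid : DSmooth ext.nerveOneToGroupoid :=
  fun _ _ hP => Gt.isPlot_nerve_iff.2 ⟨hP.1, hP.2.1⟩

/-- The triangle of the nerve of `Γt ⇉ Γt ⇉ M` with edges `g₀₁`, `g₁₂` and `g₁₂ g₀₁`, for a
triangle of the nerve of `Γt ×_Γ Γt ⇉ Γt ⇉ M`. -/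
def nerveTwoToGroupoid (x : ext.twoGroupoid.Nerve 2) : Gt.toTwoGroupoid.Nerve 2 :=
  Gt.nerveOfCone ![Gt.one (x.vertex 0), x.edge 0 1 (by decide),
    Gt.mul (x.edge 1 2 (by decide)) (x.edge 0 1 (by decide))
      ((x.s_edge 1 2 _).trans (x.t_edge 0 1 _).symm)] <| by
    have h : ∀ i, Gt.s (![Gt.one (x.vertex 0), x.edge 0 1 (by decide),
        Gt.mul (x.edge 1 2 (by decide)) (x.edge 0 1 (by decide))
          ((x.s_edge 1 2 _).trans (x.t_edge 0 1 _).symm)] i) = x.vertex 0 := by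
      intro i
      fin_cases i
      exacts [Gt.s_one _, x.s_edge 0 1 _, (Gt.s_mul _ _ _).trans (x.s_edge 0 1 _)]
    exact fun i j => (h i).trans (h j).symm

theorem nerveTwoToGroupoid_edge (x : ext.twoGroupoid.Nerve 2) :
    (ext.nerveTwoToGroupoid x).edge 0 1 (by decide) = x.edge 0 1 (by decide) ∧
    (ext.nerveTwoToGroupoid x).edge 0 2 (by decide) = (x.tri 0 1 2 (by decide) (by decide)).1.1 ∧
    (ext.nerveTwoToGroupoid x).edge 1 2 (by decide) = x.edge 1 2 (by decide) := by
  have h01 : Gt.s (x.edge 0 1 (by decide)) = Gt.s (Gt.one (x.vertex 0)) :=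
    (x.s_edge 0 1 _).trans (Gt.s_one _).symm
  refine ⟨Gt.div_one _ _ h01, ?_, Gt.mul_div_cancel _ _ _ (Gt.s_mul _ _ _)⟩
  exact (Gt.div_one _ _ ((Gt.s_mul _ _ _).trans h01)).trans (x.u_tri 0 1 2 _ _).symm

theorem dSmooth_nerveTwoToGroupoid : DSmooth ext.nerveTwoToGroupoid := by
  intro n P hP
  refine Gt.isPlot_nerveOfCone (a := fun i y => ![Gt.one ((P y).vertex 0),
    (P y).edge 0 1 (by decide), Gt.mul ((P y).edge 1 2 (by decide)) ((P y).edge 0 1 (by decide))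
      (((P y).s_edge 1 2 _).trans ((P y).t_edge 0 1 _).symm)] i) (fun i => ?_) _
  fin_cases i
  · exact Gt.smooth_one.comp (hP.1 0)
  · exact hP.2.1 0 1 _
  · exact Gt.smooth_mul n _ _ _ (hP.2.1 1 2 _) (hP.2.1 0 1 _)

theorem φ_nerveTwoToGroupoid (x : ext.twoGroupoid.Nerve 2) :
    ext.φGroupoidHom.nerve 2 (ext.nerveTwoToGroupoid x) = ext.φHom.nerve 2 x := by
  obtain ⟨h01, h02, h12⟩ := ext.nerveTwoToGroupoid_edge x
  refine G.nerve_ext ?_ ?_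
  · funext i
    fin_cases i
    · exact Gt.t_one _
    · exact x.t_edge 0 1 _
    · exact (Gt.t_mul _ _ _).trans (x.t_edge 1 2 _)
  · funext i j hij
    revert i j hij
    refine forall_fin_three_lt (congrArg ext.φ h01) ?_ (congrArg ext.φ h12)
    have h : (x.tri 0 1 2 (by decide) (by decide)).1.2 = x.edge 0 2 (by decide) :=
      x.l_tri 0 1 2 _ _
    exact (congrArg ext.φ h02).trans
      ((x.tri 0 1 2 (by decide) (by decide)).2.trans (congrArg ext.φ h))

variable {ext}

/-- On `N_2` of `Γt ×_Γ Γt ⇉ Γt ⇉ M`, pulling back `∂θ` through the triangle with third edge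
`g₁₂ g₀₁` instead of `g₀₂` changes it by the angular form of `(g₁₂ g₀₁) g₀₂⁻¹`. -/
theorem IsConnection.pullback_nerveTwoToGroupoid {θ : ManifoldForm k Γt 1}
    (hθ : ext.IsConnection θ) :
    Form.pullback ext.nerveTwoToGroupoid ext.dSmooth_nerveTwoToGroupoid 1
        (Gt.toTwoGroupoid.simpD 1 1 (Gt.toTwoGroupoid.edgeForm 1 0 1 (by decide) θ)) =
      ext.twoGroupoid.simpD 1 1 (ext.twoGroupoid.edgeForm 1 0 1 (by decide) θ) +
        Form.pullback (ext.fHom.nerve 2) (ext.fHom.dSmooth_nerve 2) 1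
          (circleTwoGroup.ofTwoArrows angularForm ⟨(1, 2), rfl⟩) := by
  let _ := manifoldDiffeology k Γt
  rw [TwoGroupoid.simpD_edgeForm, TwoGroupoid.simpD_edgeForm]
  ext n P x v
  have hT : @IsPlot _ ext.fibreDiffeology n
      fun y => (P.1 y).tri 0 1 2 (by decide) (by decide) := P.2.2.2 0 1 2 _ _
  have key := congrArg (fun η : @Form ext.FibreProduct ext.fibreDiffeology 1 =>
    @Form.on _ ext.fibreDiffeology _ _ η ⟨_, hT⟩ x v) hθ.pullback_pr₁
  let T := fun (Q : EuclideanSpace ℝ (Fin n) → Γt) (hQ : IsPlot Q) => θ.on ⟨Q, hQ⟩ x v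
  have hT' : ∀ {Q Q' : EuclideanSpace ℝ (Fin n) → Γt} (hQ : IsPlot Q) (hQ' : IsPlot Q'),
      Q = Q' → T Q hQ = T Q' hQ' := by
    rintro Q _ _ _ rfl
    rfl
  have hP := ext.dSmooth_nerveTwoToGroupoid n P.1 P.2
  have e01 := hT' (hP.2.1 0 1 (by decide)) (P.2.2.1 0 1 (by decide))
    (funext fun y => (ext.nerveTwoToGroupoid_edge (P.1 y)).1)
  have e02 := hT' (hP.2.1 0 2 (by decide)) (ext.dSmooth_pr₁ n _ hT)
    (funext fun y => (ext.nerveTwoToGroupoid_edge (P.1 y)).2.1)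
  have e12 := hT' (hP.2.1 1 2 (by decide)) (P.2.2.1 1 2 (by decide))
    (funext fun y => (ext.nerveTwoToGroupoid_edge (P.1 y)).2.2)
  have e02' := hT' (P.2.2.1 0 2 (by decide)) (ext.dSmooth_pr₂ n _ hT)
    (funext fun y => ((P.1 y).l_tri 0 1 2 (by decide) (by decide)).symm)
  let A := angularFun (fun y => (ext.diff ((P.1 y).tri 0 1 2 (by decide) (by decide)) : ℂ)) x (v 0)
  have key' : T _ (ext.dSmooth_pr₁ n _ hT) = T _ (ext.dSmooth_pr₂ n _ hT) + A := key
  change -(T _ (hP.2.1 1 2 (by decide)) - T _ (hP.2.1 0 2 (by decide)) +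
      T _ (hP.2.1 0 1 (by decide))) =
    -(T _ (P.2.2.1 1 2 (by decide)) - T _ (P.2.2.1 0 2 (by decide)) +
      T _ (P.2.2.1 0 1 (by decide))) + A
  rw [e01, e02, e12, e02', key']
  ring

/-- In the total complex of `Γt ×_Γ Γt ⇉ Γt ⇉ M`, the cochains `φ^* Ω_θ` and `f^* dt` differ by the
coboundary of `θ`. -/
theorem IsConnection.totalD_ofOneArrows [IsManifold (𝓡 k) ∞ Γt] [IsManifold (𝓡 g) ∞ Γ]
    {θ : ManifoldForm k Γt 1} (hθ : ext.IsConnection θ)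
    {Om : G.toTwoGroupoid.cocycles 3} (h : ext.IsInducedCocycle θ Om) :
    ext.twoGroupoid.totalD 2 (ext.twoGroupoid.ofOneArrows θ) =
      ext.φHom.pullback 3 (Om : G.toTwoGroupoid.TotalForm 3) -
        ext.fHom.pullback 3 (circleTwoGroup.ofTwoArrows angularForm) := by
  have hOm := h.trans (TwoGroupoid.totalD_ofOneArrows (G := Gt.toTwoGroupoid) θ)
  have h03 : Om.1 ⟨(0, 3), rfl⟩ = 0 :=
    Form.pullback_injective (ext.φGroupoidHom.dSmooth_nerve 3) (ext.hasLocalLifts_nerve 3)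
      ((congrFun hOm ⟨(0, 3), rfl⟩).trans (map_zero _).symm)
  have h30 : Om.1 ⟨(3, 0), rfl⟩ = 0 :=
    Form.pullback_injective (ext.φGroupoidHom.dSmooth_nerve 0) (ext.hasLocalLifts_nerve 0)
      ((congrFun hOm ⟨(3, 0), rfl⟩).trans (map_zero _).symm)
  have hf : ∀ p q, Form.pullback (ext.fHom.nerve q) (ext.fHom.dSmooth_nerve q) p 0 = 0 :=
    fun _ _ => map_zero _
  have hφ : ∀ p q, Form.pullback (ext.φHom.nerve q) (ext.φHom.dSmooth_nerve q) p 0 = 0 :=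
    fun _ _ => map_zero _
  rw [TwoGroupoid.totalD_ofOneArrows]
  refine eq_sub_of_add_eq (funext (TwoGroupoid.forall_totalForm_three ?_ ?_ ?_ ?_))
  · refine (zero_add _).trans ((hf 0 3).trans ((congrArg _ h03).trans (hφ 0 3)).symm)
  · refine hθ.pullback_nerveTwoToGroupoid.symm.trans ?_
    refine (congrArg (Form.pullback ext.nerveTwoToGroupoid ext.dSmooth_nerveTwoToGroupoid 1)
      (congrFun hOm ⟨(1, 2), rfl⟩)).symm.trans ?_
    exact Form.pullback_pullback_of_eq _ (ext.φGroupoidHom.dSmooth_nerve 2) _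
      ext.φ_nerveTwoToGroupoid _
  · refine ((congrArg (ext.twoGroupoid.edgeForm 1 0 1 (by decide)
      (@Form.d Γt (manifoldDiffeology k Γt) 1 θ) + ·) (hf 2 1)).trans (add_zero _)).trans ?_
    refine (congrArg (Form.pullback ext.nerveOneToGroupoid ext.dSmooth_nerveOneToGroupoid 2)
      (congrFun hOm ⟨(2, 1), rfl⟩)).symm.trans ?_
    exact Form.pullback_pullback_of_eq ext.dSmooth_nerveOneToGroupoid
      (ext.φGroupoidHom.dSmooth_nerve 1) (ext.φHom.dSmooth_nerve 1)
      (fun _ => G.nerve_ext rfl rfl) _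
  · refine (zero_add _).trans ((hf 3 0).trans ((congrArg _ h30).trans (hφ 3 0)).symm)

end CentralExtension

end Lie

end TwoGpd

theorem theorem4p13 {m g k : ℕ} {M : Type*} {Γ : Type*} {Γt : Type*}
    [TopologicalSpace M] [ChartedSpace (EuclideanSpace ℝ (Fin m)) M] [IsManifold (𝓡 m) ∞ M]
    [TopologicalSpace Γ] [ChartedSpace (EuclideanSpace ℝ (Fin g)) Γ] [IsManifold (𝓡 g) ∞ Γ]
    [TopologicalSpace Γt] [ChartedSpace (EuclideanSpace ℝ (Fin k)) Γt] [IsManifold (𝓡 k) ∞ Γt]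
    (Gt : TwoGpd.LieGroupoid m k M Γt) (G : TwoGpd.LieGroupoid m g M Γ)
    (ext : TwoGpd.CentralExtension Gt G)
    (θ : TwoGpd.ManifoldForm k Γt 1) (hθ : ext.IsConnection θ) :
    ∃ Om : G.toTwoGroupoid.cocycles 3,
      ext.IsInducedCocycle θ Om ∧ (∀ Om', ext.IsInducedCocycle θ Om' → Om' = Om) ∧
      ext.φHom.cohomologyMap 3 (G.toTwoGroupoid.cohomologyClass Om) =
        ext.fHom.cohomologyMap 3
          (TwoGpd.circleTwoGroup.cohomologyClass TwoGpd.angularCocycle) := by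
  obtain ⟨Om, hOm⟩ := hθ.exists_isInducedCocycle
  refine ⟨Om, hOm, fun Om' hOm' => Subtype.ext ?_, ?_⟩
  · exact ext.φGroupoidHom.pullback_injective ext.hasLocalLifts_nerve 3 (hOm'.trans hOm.symm)
  · exact (Submodule.Quotient.eq _).2
      ⟨ext.twoGroupoid.ofOneArrows θ, hθ.totalD_ofOneArrows hOm⟩
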